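/- Let $z\in\mathbb{C}$ with $\mathrm{Re}\,z\ge 1$ and let $\ell$ be an integer with $0\le \ell\le\lfloor \mathrm{Re}\,z-\tfrac12\rfloor$. Put $$H_0(\gamma)=(\cos^2\pi\gamma)^z\sum_{k=0}^{\ell}\binom{z+\ell}{k}(\sin^2\pi\gamma)^k(\cos^2\pi\gamma)^{\ell-k},\qquad \binom{w}{k}=\frac{\Gamma(w+1)}{\Gamma(k+1)\Gamma(w-k+1)},$$ and $\eta(\gamma)=1-\left(|H_0(\gamma)|^2+|H_0(\gamma+\tfrac12)|^2\right)$ for $\gamma\in\mathbb{R}$. Fourier transforms are normalized as $\widehat f(\gamma)=\int_{\mathbb{R}} f(t)e^{-2\pi i t\gamma}\,dt$ and extended to $L^2(\mathbb{R})$; $(Df)(x)=\sqrt2 f(2x)$ and $(T_kf)(x)=f(x-k)$. (a) For every $\gamma\in\mathbb R$ the infinite product $\Phi(\gamma)=\prod_{m=1}^\infty H_0(2^{-m}\gamma)$ converges unconditionally, and $\Phi(\gamma)=H_0(\gamma/2)\Phi(\gamma/2)$. (b) Let $\sigma:\mathbb R\to\mathbb C$ be a (Lebesgue measurable) $1$-periodic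 function with $|\sigma(\gamma)|^2=\eta(\gamma)$ for all $\gamma\in\mathbb R$ (so that, in particular, $\eta\ge 0$). Then there is a unique $\varphi\in L^2(\mathbb R)$ with $\widehat\varphi=\Phi$ almost everywhere. Define $$H_1(\gamma)=e^{2\pi i\gamma}\,\overline{H_0(\gamma+\tfrac12)},\qquad H_2(\gamma)=\tfrac1{\sqrt2}\,\sigma(\gamma),\qquad H_3(\gamma)=\tfrac1{\sqrt2}\,e^{2\pi i\gamma}\sigma(\gamma).$$ There are unique $\psi_1,\psi_2,\psi_3\in L^2(\mathbb R)$ with $\widehat{\psi_n}(2\gamma)=H_n(\gamma)\widehat\varphi(\gamma)$ for almost every $\gamma$, and $\{D^jT_k\psi_n : j,k\in\mathbb Z,\ n=1,2,3\}$ is a Parseval frame for $L^2(\mathbb R)$, that is, $$\sum_{n=1}^3\sum_{j,k\in\mathbb Z}|\langle f,D^jT_k\psi_n\rangle|^2=\|f\|^2\qquad\text{for all } f\in L^2(\mathbb R).$$ (c) A measurable function $\sigma$ as in (b) exists whenever $\sum_{j=0}^{\ell}\arctan\frac{\mathrm{Im}\,z}{\mathrm{Re}\,z+j}\in\left(-\tfrac\pi2,\tfrac\pi2\right)$;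 in particular for all real $z$, and for all $z$ if $\ell=0$. -/

import Mathlib

open MeasureTheory FourierTransform

noncomputable section

namespace PseudoSpline

/-- The complex Hilbert space `L²(ℝ)`. -/
abbrev L2R : Type := Lp ℂ 2 (volume : Measure ℝ)

/-! ### Translation and dilation on `L²(ℝ)` -/

/-- Translation by a real number: `(T_a f)(x) = f (x - a)`. -/
def translation (a : ℝ) : L2R →ₗᵢ[ℂ] L2R :=
  Lp.compMeasurePreservingₗᵢ ℂ (fun x : ℝ => x - a) (measurePreserving_sub_right volume a)

theorem coeFn_translation (a : ℝ) (f : L2R) :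
    (translation a f : ℝ → ℂ) =ᵐ[volume] fun x => f (x - a) :=
  Lp.coeFn_compMeasurePreserving f (measurePreserving_sub_right volume a)

theorem eLpNorm_dilation {a : ℝ} (ha : 0 < a) {f : ℝ → ℂ} (hf : MemLp f 2 volume) :
    eLpNorm (fun x => (Real.sqrt a : ℂ) * f (a * x)) 2 volume = eLpNorm f 2 volume := by
  have hm : Measure.map (fun x : ℝ => a * x) volume = ENNReal.ofReal a⁻¹ • volume := by
    rw [Real.map_volume_mul_left ha.ne', abs_of_pos (inv_pos.2 ha)]
  have hf' : AEStronglyMeasurable f (Measure.map (fun x : ℝ => a * x) volume) := by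
    rw [hm]; exact hf.1.smul_measure _
  have h1 : eLpNorm (fun x => f (a * x)) 2 volume
      = ENNReal.ofReal a⁻¹ ^ (1 / 2 : ℝ) * eLpNorm f 2 volume := by
    have h := eLpNorm_map_measure (p := 2) hf' (measurable_const_mul a).aemeasurable
    rw [hm, eLpNorm_smul_measure_of_ne_zero
      (by simpa using ha)] at h
    rw [← Function.comp_def, ← h]
    simp
  have h2 : (fun x => (Real.sqrt a : ℂ) * f (a * x))
      = (Real.sqrt a : ℂ) • fun x => f (a * x) := rfl
  rw [h2, eLpNorm_const_smul, h1, ← mul_assoc]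
  have h3 : ‖(Real.sqrt a : ℂ)‖ₑ * ENNReal.ofReal a⁻¹ ^ (1 / 2 : ℝ) = 1 := by
    rw [← ofReal_norm, Complex.norm_real, Real.norm_of_nonneg (Real.sqrt_nonneg a),
      ENNReal.ofReal_rpow_of_pos (inv_pos.2 ha), ← Real.sqrt_eq_rpow,
      ← ENNReal.ofReal_mul (Real.sqrt_nonneg a), Real.sqrt_inv,
      mul_inv_cancel₀ (Real.sqrt_pos.2 ha).ne', ENNReal.ofReal_one]
  rw [h3, one_mul]

theorem memLp_dilation {a : ℝ} (ha : 0 < a) {f : ℝ → ℂ} (hf : MemLp f 2 volume) :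
    MemLp (fun x => (Real.sqrt a : ℂ) * f (a * x)) 2 volume := by
  refine ⟨?_, by rw [eLpNorm_dilation ha hf]; exact hf.2⟩
  have h := hf.1.comp_quasiMeasurePreserving (Measure.quasiMeasurePreserving_smul volume ha.ne')
  exact h.const_mul _

theorem ae_mul_left {a : ℝ} (ha : 0 < a) {p : ℝ → Prop} (h : ∀ᵐ x ∂volume, p x) :
    ∀ᵐ x ∂volume, p (a * x) :=
  (Measure.quasiMeasurePreserving_smul (volume : Measure ℝ) ha.ne').ae h

/-- Normalized dilation by `a > 0`: `f ↦ √a f (a x)`, as a linear isometry of `L²(ℝ)`. -/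
def dilationₗᵢ (a : ℝ) (ha : 0 < a) : L2R →ₗᵢ[ℂ] L2R where
  toFun f := (memLp_dilation ha (Lp.memLp f)).toLp _
  map_add' f g := by
    apply Lp.ext
    filter_upwards [MemLp.coeFn_toLp (memLp_dilation ha (Lp.memLp (f + g))),
      MemLp.coeFn_toLp (memLp_dilation ha (Lp.memLp f)),
      MemLp.coeFn_toLp (memLp_dilation ha (Lp.memLp g)),
      Lp.coeFn_add ((memLp_dilation ha (Lp.memLp f)).toLp _)
        ((memLp_dilation ha (Lp.memLp g)).toLp _),
      ae_mul_left ha (Lp.coeFn_add f g)] with x h1 h2 h3 h4 h5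
    rw [h1, h4, Pi.add_apply, h2, h3, h5, Pi.add_apply, mul_add]
  map_smul' c f := by
    apply Lp.ext
    filter_upwards [MemLp.coeFn_toLp (memLp_dilation ha (Lp.memLp (c • f))),
      MemLp.coeFn_toLp (memLp_dilation ha (Lp.memLp f)),
      Lp.coeFn_smul c ((memLp_dilation ha (Lp.memLp f)).toLp _),
      ae_mul_left ha (Lp.coeFn_smul c f)] with x h1 h2 h3 h4
    rw [RingHom.id_apply, h1, h3, Pi.smul_apply, h2, h4, Pi.smul_apply, smul_eq_mul, smul_eq_mul]
    ring
  norm_map' f := by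
    change ‖(memLp_dilation ha (Lp.memLp f)).toLp _‖ = ‖f‖
    rw [Lp.norm_toLp, eLpNorm_dilation ha (Lp.memLp f), Lp.norm_def]

theorem coeFn_dilationₗᵢ (a : ℝ) (ha : 0 < a) (f : L2R) :
    (dilationₗᵢ a ha f : ℝ → ℂ) =ᵐ[volume] fun x => (Real.sqrt a : ℂ) * f (a * x) :=
  MemLp.coeFn_toLp (memLp_dilation ha (Lp.memLp f))

theorem dilationₗᵢ_inv (a : ℝ) (ha : 0 < a) (f : L2R) :
    dilationₗᵢ a ha (dilationₗᵢ a⁻¹ (inv_pos.2 ha) f) = f := by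
  apply Lp.ext
  filter_upwards [coeFn_dilationₗᵢ a ha (dilationₗᵢ a⁻¹ (inv_pos.2 ha) f),
    ae_mul_left ha (coeFn_dilationₗᵢ a⁻¹ (inv_pos.2 ha) f)] with x h1 h2
  rw [h1, h2, ← mul_assoc, ← mul_assoc, inv_mul_cancel₀ ha.ne', one_mul, Real.sqrt_inv,
    ← Complex.ofReal_mul, mul_inv_cancel₀ (Real.sqrt_pos.2 ha).ne', Complex.ofReal_one, one_mul]

/-- The unitary dyadic dilation operator `(D f)(x) = √2 f (2 x)` on `L²(ℝ)`. -/
def dilation : L2R ≃ₗᵢ[ℂ] L2R :=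
  LinearIsometryEquiv.ofSurjective (dilationₗᵢ 2 two_pos) fun f =>
    ⟨dilationₗᵢ 2⁻¹ (inv_pos.2 two_pos) f, dilationₗᵢ_inv 2 two_pos f⟩

theorem coeFn_dilation (f : L2R) :
    (dilation f : ℝ → ℂ) =ᵐ[volume] fun x => (Real.sqrt 2 : ℂ) * f (2 * x) :=
  coeFn_dilationₗᵢ 2 two_pos f

/-- The wavelet system `{D^j T_k ψ_n}`, where `D^j`, `j ∈ ℤ`, is the integer power of the unitary
operator `D` in the group of unitary operators. -/
def waveletSystem {N : ℕ} (ψ : Fin N → L2R) : Fin N × ℤ × ℤ → L2R :=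
  fun i => (dilation ^ i.2.1) (translation (i.2.2 : ℝ) (ψ i.1))

/-- A family `e` is a Parseval frame when `∑ᵢ |⟨f, eᵢ⟩|² = ‖f‖²` for every vector `f`. -/
def IsParsevalFrame {ι H : Type*} [NormedAddCommGroup H] [InnerProductSpace ℂ H]
    (e : ι → H) : Prop :=
  ∀ f : H, HasSum (fun i => ‖inner ℂ f (e i)‖ ^ 2) (‖f‖ ^ 2)

/-! ### Pseudo-splines of complex order -/

/-- The binomial coefficient `Γ(w + 1) / (Γ(k + 1) Γ(w - k + 1))`. -/
def cbinom (w : ℂ) (k : ℕ) : ℂ :=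
  Complex.Gamma (w + 1) / (Complex.Gamma (k + 1) * Complex.Gamma (w - k + 1))

/-- The filter
`H₀(γ) = (cos² πγ)^z ∑_{k=0}^ℓ binom(z + ℓ, k) (sin² πγ)^k (cos² πγ)^(ℓ - k)`. -/
def lowpass (z : ℂ) (ℓ : ℕ) (γ : ℝ) : ℂ :=
  ((Real.cos (Real.pi * γ) ^ 2 : ℝ) : ℂ) ^ z *
    ∑ k ∈ Finset.range (ℓ + 1), cbinom (z + ℓ) k *
      ((Real.sin (Real.pi * γ) ^ 2 : ℝ) : ℂ) ^ k *
      ((Real.cos (Real.pi * γ) ^ 2 : ℝ) : ℂ) ^ (ℓ - k)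

/-- The infinite product `∏_{m ≥ 1} H₀(2^{-m} γ)`, the Fourier transform of the pseudo-spline. -/
def phiHat (z : ℂ) (ℓ : ℕ) (γ : ℝ) : ℂ :=
  ∏' m : ℕ, lowpass z ℓ (γ / 2 ^ (m + 1))

/-- `η(γ) = 1 - (|H₀(γ)|² + |H₀(γ + 1/2)|²)`. -/
def eta (z : ℂ) (ℓ : ℕ) (γ : ℝ) : ℝ :=
  1 - (‖lowpass z ℓ γ‖ ^ 2 + ‖lowpass z ℓ (γ + 1 / 2)‖ ^ 2)

/-- The three filters `H₁ = e^{2πiγ} conj H₀(γ + 1/2)`, `H₂ = σ/√2`, `H₃ = e^{2πiγ} σ/√2`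
(with indices `0, 1, 2`). -/
def highpass (z : ℂ) (ℓ : ℕ) (σ : ℝ → ℂ) : Fin 3 → ℝ → ℂ :=
  ![fun γ => Complex.exp (2 * Real.pi * Complex.I * γ) *
      (starRingEnd ℂ) (lowpass z ℓ (γ + 1 / 2)),
    fun γ => 1 / (Real.sqrt 2 : ℂ) * σ γ,
    fun γ => 1 / (Real.sqrt 2 : ℂ) * Complex.exp (2 * Real.pi * Complex.I * γ) * σ γ]

/-- `φ ∈ L²(ℝ)` is the pseudo-spline of order `(z, ℓ)`: its (Plancherel) Fourier transform is the
infinite product. -/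
def IsPseudoSpline (z : ℂ) (ℓ : ℕ) (φ : L2R) : Prop :=
  ((𝓕 φ : L2R) : ℝ → ℂ) =ᵐ[volume] phiHat z ℓ

/-- The functions `ψ_n` are generated from `φ` by the filters `H_n`:
`ψ̂_n(2γ) = H_n(γ) φ̂(γ)` for almost every `γ`. -/
def IsGeneratedBy {N : ℕ} (H : Fin N → ℝ → ℂ) (φ : L2R) (ψ : Fin N → L2R) : Prop :=
  ∀ n, ∀ᵐ γ : ℝ, (𝓕 (ψ n) : L2R) (2 * γ) = H n γ * (𝓕 φ : L2R) γ

end PseudoSpline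

end

noncomputable section

namespace PseudoSpline

/-! ### The Fourier transform, translations and dilations on `L²(ℝ)` -/

/-! The frame property is an instance of the unitary extension principle
(`isParsevalFrame_waveletSystem`). Let `E(g) = ∑_k |⟨g, T_k φ⟩|²`. By Parseval for Fourier series,
`E(g)` is the `L²(0,1)` energy of the bracket of `𝓕 g` and `Φ`. At every `γ` the vectors of filter
values at `γ` and `γ + 1/2` are orthonormal, which yields `E(D⁻¹g) = E(g) + ∑_n ∑_k |⟨g, T_k ψ_n⟩|²`
(`shiftEnergy_dilation_symm`). Summed over all scales the wavelet energies telescope to `lim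
E(D^{-J} f) - lim E(D^J f)`. The first limit is `‖f‖²` because `Φ` tends to 1 at 0; the second is 0
because dilates of a compactly supported function concentrate near a point.

The product converges absolutely since `H₀(γ) - 1 = O(γ)`. The bound `|H₀(γ)|² + |H₀(γ + 1/2)|² ≤
1`, which is `η ≥ 0`, passes through the partial products to `∑_m |Φ(γ + m)|² ≤ 1`
(`tsum_enorm_sq_dyadicProd_le`); this puts `Φ` in `L²` and makes the translates of `φ` a Bessel
sequence.

For the existence of `σ`, write `H₀ = F(cos² πγ)`. The derivative of `F` collapses to a single term
(`hasDerivAt_profile`), and under the arctangent condition `(|F|²)'` is a combination of `y^(2 Re z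
- 1) (1 - y)^(ℓ + k)` with nonnegative coefficients. As `2 Re z - 1 ≥ 2ℓ ≥ ℓ + k`, each such term at
`y ≤ 1/2` is at most its value at `1 - y`. Hence `|F(y)|² + |F(1 - y)|²` decreases on `[0, 1/2]`
from its value 1 at 0, and `σ = √η` is admissible. -/

theorem norm_character (a γ : ℝ) : ‖Complex.exp (-2 * Real.pi * Complex.I * a * γ)‖ = 1 := by
  have : (-2 * Real.pi * Complex.I * a * γ : ℂ) = ((-2 * Real.pi * a * γ : ℝ) : ℂ) * Complex.I := by
    push_cast; ring
  rw [this, Complex.norm_exp_ofReal_mul_I]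

theorem memLp_modulation (a : ℝ) {f : ℝ → ℂ} (hf : MemLp f 2 volume) :
    MemLp (fun γ : ℝ => Complex.exp (-2 * Real.pi * Complex.I * a * γ) * f γ) 2 volume := by
  refine hf.congr_norm ((Continuous.aestronglyMeasurable (by fun_prop)).mul hf.1)
    (Filter.Eventually.of_forall fun γ => ?_)
  rw [norm_mul, norm_character, one_mul]

/-- Multiplication by the character `γ ↦ e^{-2πiaγ}`, as a linear isometry of `L²(ℝ)`. -/
def modulation (a : ℝ) : L2R →ₗᵢ[ℂ] L2R where
  toFun f := (memLp_modulation a (Lp.memLp f)).toLp _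
  map_add' f g := by
    apply Lp.ext
    filter_upwards [MemLp.coeFn_toLp (memLp_modulation a (Lp.memLp (f + g))),
      MemLp.coeFn_toLp (memLp_modulation a (Lp.memLp f)),
      MemLp.coeFn_toLp (memLp_modulation a (Lp.memLp g)),
      Lp.coeFn_add ((memLp_modulation a (Lp.memLp f)).toLp _)
        ((memLp_modulation a (Lp.memLp g)).toLp _),
      Lp.coeFn_add f g] with x h1 h2 h3 h4 h5
    rw [h1, h4, Pi.add_apply, h2, h3, h5, Pi.add_apply, mul_add]
  map_smul' c f := by
    apply Lp.ext
    filter_upwards [MemLp.coeFn_toLp (memLp_modulation a (Lp.memLp (c • f))),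
      MemLp.coeFn_toLp (memLp_modulation a (Lp.memLp f)),
      Lp.coeFn_smul c ((memLp_modulation a (Lp.memLp f)).toLp _),
      Lp.coeFn_smul c f] with x h1 h2 h3 h4
    rw [RingHom.id_apply, h1, h3, Pi.smul_apply, h2, h4, Pi.smul_apply, smul_eq_mul, smul_eq_mul]
    ring
  norm_map' f := by
    change ‖(memLp_modulation a (Lp.memLp f)).toLp _‖ = ‖f‖
    rw [Lp.norm_toLp, Lp.norm_def]
    congr 1
    refine eLpNorm_congr_norm_ae (Filter.Eventually.of_forall fun γ => ?_)
    rw [norm_mul, norm_character, one_mul]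

theorem coeFn_modulation (a : ℝ) (f : L2R) :
    (modulation a f : ℝ → ℂ) =ᵐ[volume]
      fun γ : ℝ => Complex.exp (-2 * Real.pi * Complex.I * a * γ) * f γ :=
  MemLp.coeFn_toLp (memLp_modulation a (Lp.memLp f))

theorem continuous_fourier_L2R : Continuous (fun f : L2R => (𝓕 f : L2R)) :=
  (Lp.fourierTransformₗᵢ ℝ ℂ).continuous

/-- Translations become modulations under the Fourier transform. -/
theorem fourier_translation (a : ℝ) (f : L2R) : 𝓕 (translation a f) = modulation a (𝓕 f) := by
  -- Both sides are continuous in `f`, so Schwartz functions suffice; there the transform is an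
  -- honest integral.
  refine DenseRange.induction_on (p := fun f : L2R => 𝓕 (translation a f) = modulation a (𝓕 f))
    (SchwartzMap.denseRange_toLpCLM (F := ℂ) (E := ℝ) (p := 2) (μ := volume)
      ENNReal.ofNat_ne_top) f ?_ ?_
  · exact isClosed_eq (continuous_fourier_L2R.comp (translation a).continuous)
      ((modulation a).continuous.comp continuous_fourier_L2R)
  intro g
  have h1 : translation a (SchwartzMap.toLpCLM ℝ ℂ 2 volume g)
      = (g.compSubConstCLM ℂ a).toLp 2 volume := by
    apply Lp.ext
    filter_upwards [coeFn_translation a (SchwartzMap.toLpCLM ℝ ℂ 2 volume g),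
      (measurePreserving_sub_right volume a).quasiMeasurePreserving.ae
        (g.coeFn_toLp 2 volume), (g.compSubConstCLM ℂ a).coeFn_toLp 2 volume] with x e1 e2 e3
    rw [e1, e3]
    exact e2
  change 𝓕 (translation a (SchwartzMap.toLpCLM ℝ ℂ 2 volume g))
    = modulation a (𝓕 (g.toLp 2 volume))
  rw [h1, SchwartzMap.toLp_fourier_eq, SchwartzMap.toLp_fourier_eq]
  apply Lp.ext
  filter_upwards [(𝓕 (g.compSubConstCLM ℂ a)).coeFn_toLp 2 volume,
    coeFn_modulation a ((𝓕 g).toLp 2 volume), (𝓕 g).coeFn_toLp 2 volume] with γ e1 e2 e3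
  rw [e1, e2, e3, SchwartzMap.fourier_coe, SchwartzMap.fourier_coe,
    Real.fourier_eq', Real.fourier_eq', ← integral_const_mul]
  conv_rhs => rw [← integral_sub_right_eq_self _ a]
  refine integral_congr_ae (Filter.Eventually.of_forall fun x => ?_)
  simp only [SchwartzMap.compSubConstCLM_apply, smul_eq_mul, ← mul_assoc, ← Complex.exp_add]
  congr 2
  simp
  ring

/-- Dilations become inverse dilations under the Fourier transform. -/
theorem fourier_dilation_symm (f : L2R) : 𝓕 (dilation.symm f) = dilation (𝓕 f) := by
  -- `dilation.symm` is an abstract inverse; `dilationₗᵢ 2⁻¹` is the same operator with a pointwise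
  -- formula.
  have key : ∀ f : L2R, 𝓕 (dilationₗᵢ 2⁻¹ (inv_pos.2 two_pos) f) = dilation (𝓕 f) := by
    intro f
    refine DenseRange.induction_on
      (p := fun f : L2R => 𝓕 (dilationₗᵢ 2⁻¹ (inv_pos.2 two_pos) f) = dilation (𝓕 f))
      (SchwartzMap.denseRange_toLpCLM (F := ℂ) (E := ℝ) (p := 2) (μ := volume)
        ENNReal.ofNat_ne_top) f ?_ ?_
    · exact isClosed_eq (continuous_fourier_L2R.comp (dilationₗᵢ 2⁻¹ _).continuous)
        (dilation.continuous.comp continuous_fourier_L2R)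
    intro g
    let L : ℝ ≃L[ℝ] ℝ := ContinuousLinearEquiv.smulLeft (Units.mk0 (2⁻¹ : ℝ) (by norm_num))
    let g' : SchwartzMap ℝ ℂ := (Real.sqrt 2⁻¹ : ℂ) • SchwartzMap.compCLMOfContinuousLinearEquiv ℂ L g
    have hg' : ∀ x, g' x = (Real.sqrt 2⁻¹ : ℂ) * g (2⁻¹ * x) := fun x => rfl
    have h1 : dilationₗᵢ 2⁻¹ (inv_pos.2 two_pos) (SchwartzMap.toLpCLM ℝ ℂ 2 volume g)
        = g'.toLp 2 volume := by
      apply Lp.ext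
      filter_upwards [coeFn_dilationₗᵢ 2⁻¹ (inv_pos.2 two_pos) (SchwartzMap.toLpCLM ℝ ℂ 2 volume g),
        ae_mul_left (inv_pos.2 two_pos) (g.coeFn_toLp 2 volume), g'.coeFn_toLp 2 volume]
        with x e1 e2 e3
      rw [e1, e3, hg', ← e2]
      rfl
    rw [h1, SchwartzMap.toLp_fourier_eq]
    change _ = dilation (𝓕 (g.toLp 2 volume))
    rw [SchwartzMap.toLp_fourier_eq]
    apply Lp.ext
    filter_upwards [(𝓕 g').coeFn_toLp 2 volume,
      coeFn_dilation ((𝓕 g).toLp 2 volume), ae_mul_left two_pos ((𝓕 g).coeFn_toLp 2 volume)]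
      with γ e1 e2 e3
    rw [e1, e2, e3, SchwartzMap.fourier_coe, SchwartzMap.fourier_coe,
      Real.fourier_eq', Real.fourier_eq']
    have h2 := Measure.integral_comp_mul_left (fun v : ℝ =>
      Complex.exp (((-2 * Real.pi * inner ℝ v (2 * γ) : ℝ) : ℂ) * Complex.I) • g v) (2⁻¹ : ℝ)
    have h3 : ∀ v : ℝ, Complex.exp (((-2 * Real.pi * inner ℝ v γ : ℝ) : ℂ) * Complex.I) • g' v
        = (Real.sqrt 2⁻¹ : ℂ) * (Complex.exp (((-2 * Real.pi * inner ℝ (2⁻¹ * v) (2 * γ) : ℝ) : ℂ)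
          * Complex.I) • g (2⁻¹ * v)) := by
      intro v
      have : (inner ℝ (2⁻¹ * v) (2 * γ) : ℝ) = inner ℝ v γ := by simp; ring
      rw [hg', this, smul_eq_mul, smul_eq_mul]; ring
    simp_rw [h3]
    rw [integral_const_mul, h2, ← smul_eq_mul (a := (Real.sqrt 2⁻¹ : ℂ)), Complex.coe_smul,
      smul_smul, ← Complex.coe_smul]
    congr 1
    rw [inv_inv, abs_of_pos two_pos, Real.sqrt_inv]
    norm_cast
    have := Real.mul_self_sqrt (zero_le_two (α := ℝ))
    field_simp
    linarith
  rw [← key]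
  congr 1
  rw [LinearIsometryEquiv.symm_apply_eq]
  exact (dilationₗᵢ_inv 2 two_pos f).symm

theorem fourier_dilation_symm_ae (f : L2R) :
    ((𝓕 (dilation.symm f) : L2R) : ℝ → ℂ) =ᵐ[volume] fun γ => (Real.sqrt 2 : ℂ) * (𝓕 f : L2R) (2 * γ) := by
  rw [fourier_dilation_symm]
  exact coeFn_dilation _

/-- The inner product with a translate, on the Fourier side. -/
theorem inner_translation_eq (f g : L2R) {u v : ℝ → ℂ} (hu : (𝓕 f : L2R) =ᵐ[volume] u)
    (hv : (𝓕 g : L2R) =ᵐ[volume] v) (a : ℝ) :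
    inner ℂ f (translation a g) = ∫ γ : ℝ, Complex.exp (-2 * Real.pi * Complex.I * a * γ) *
      ((starRingEnd ℂ) (u γ) * v γ) := by
  rw [← Lp.inner_fourier_eq, fourier_translation, L2.inner_def]
  refine integral_congr_ae ?_
  filter_upwards [coeFn_modulation a (𝓕 g), hu, hv] with γ h1 h2 h3
  rw [h1, h2, h3, RCLike.inner_apply']
  ring

/-! ### Periodization and brackets -/

theorem ae_add_int {p : ℝ → Prop} (h : ∀ᵐ x ∂(volume : Measure ℝ), p x) :
    ∀ᵐ x ∂(volume : Measure ℝ), ∀ m : ℤ, p (x + m) :=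
  ae_all_iff.2 fun m => (measurePreserving_add_right volume (m : ℝ)).quasiMeasurePreserving.ae h

theorem lintegral_periodize (a : ℝ) {f : ℝ → ENNReal} (hf : AEMeasurable f volume) :
    ∫⁻ γ in Set.Ioc a (a + 1), ∑' m : ℤ, f (γ + m) = ∫⁻ γ, f γ := by
  have hm : ∀ m : ℤ, AEMeasurable (fun γ : ℝ => f (γ + m)) volume := fun m =>
    hf.comp_quasiMeasurePreserving
      (measurePreserving_add_right volume (m : ℝ)).quasiMeasurePreserving
  rw [lintegral_tsum fun m => (hm m).restrict, ← setLIntegral_univ f,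
    ← iUnion_Ioc_add_intCast a, lintegral_iUnion (fun _ => measurableSet_Ioc)
      (Set.pairwise_disjoint_Ioc_add_intCast a)]
  refine tsum_congr fun m => ?_
  have h := (measurePreserving_add_right volume (m : ℝ)).setLIntegral_comp_preimage_emb
    (measurableEmbedding_addRight (m : ℝ)) f (Set.Ioc (a + m) (a + m + 1))
  rw [← h]
  congr 2
  simp only [Set.preimage_add_const_Ioc, add_sub_cancel_right]
  congr 1
  ring

theorem lintegral_periodize_zero {f : ℝ → ENNReal} (hf : AEMeasurable f volume) :
    ∫⁻ γ in Set.Ioc (0 : ℝ) 1, ∑' m : ℤ, f (γ + m) = ∫⁻ γ, f γ := by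
  simpa using lintegral_periodize 0 hf

/-- Cauchy–Schwarz, as Hölder for counting measure. In `ENNReal` no summability is needed: a
divergent `tsum` is 0. -/
theorem enorm_tsum_mul_sq_le {ι : Type*} (a b : ι → ℂ) :
    ‖∑' m, (starRingEnd ℂ) (a m) * b m‖ₑ ^ 2 ≤ (∑' m, ‖a m‖ₑ ^ 2) * ∑' m, ‖b m‖ₑ ^ 2 := by
  let _ : MeasurableSpace ι := ⊤
  have h := ENNReal.lintegral_mul_le_Lp_mul_Lq (Measure.count : Measure ι)
    (Real.HolderConjugate.two_two) (f := fun m => ‖a m‖ₑ) (g := fun m => ‖b m‖ₑ)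
    (by fun_prop) (by fun_prop)
  simp only [lintegral_count, Pi.mul_apply, ENNReal.rpow_two] at h
  have h1 : ‖∑' m, (starRingEnd ℂ) (a m) * b m‖ₑ ≤ ∑' m, ‖a m‖ₑ * ‖b m‖ₑ := by
    refine enorm_tsum_le_tsum_enorm.trans (le_of_eq (tsum_congr fun m => ?_))
    rw [enorm_mul, RCLike.enorm_conj]
  refine (pow_le_pow_left' (h1.trans h) 2).trans (le_of_eq ?_)
  rw [mul_pow, ← ENNReal.rpow_two, ← ENNReal.rpow_two, ← ENNReal.rpow_mul, ← ENNReal.rpow_mul]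
  norm_num

theorem summable_conj_mul {ι : Type*} {a b : ι → ℂ} (ha : ∑' m, ‖a m‖ₑ ^ 2 ≠ ⊤)
    (hb : ∑' m, ‖b m‖ₑ ^ 2 ≠ ⊤) : Summable fun m => (starRingEnd ℂ) (a m) * b m := by
  have h : ∀ c : ι → ℂ, ∑' m, ‖c m‖ₑ ^ 2 ≠ ⊤ → Summable fun m => ‖c m‖ ^ 2 := by
    intro c hc
    have hc' : ∑' m, ‖‖c m‖ ^ 2‖ₑ ≠ ⊤ := by simpa [enorm_pow] using hc
    simpa using tsum_enorm_ne_top_iff_summable_norm.1 hc'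
  refine Summable.of_norm_bounded ((h a ha).add (h b hb)) fun m => ?_
  rw [norm_mul, RCLike.norm_conj]
  nlinarith [sq_nonneg (‖a m‖ - ‖b m‖), sq_nonneg (‖a m‖ + ‖b m‖)]

/-- The bracket product `[u, v](γ) = ∑_m conj u(γ + m) v(γ + m)`. -/
def bracket (u v : ℝ → ℂ) (γ : ℝ) : ℂ :=
  ∑' m : ℤ, (starRingEnd ℂ) (u (γ + m)) * v (γ + m)

theorem lintegral_enorm_sq_ne_top {u : ℝ → ℂ} (hu : MemLp u 2 volume) :
    ∫⁻ γ, ‖u γ‖ₑ ^ 2 ≠ ⊤ := by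
  have := (eLpNorm_lt_top_iff_lintegral_rpow_enorm_lt_top two_ne_zero ENNReal.ofNat_ne_top).1 hu.2
  simpa using this.ne

theorem aemeasurable_enorm_sq {u : ℝ → ℂ} (hu : MemLp u 2 volume) :
    AEMeasurable (fun γ => ‖u γ‖ₑ ^ 2) volume := hu.1.enorm.pow_const 2

theorem ae_tsum_enorm_sq_ne_top {u : ℝ → ℂ} (hu : MemLp u 2 volume) :
    ∀ᵐ γ : ℝ, ∑' m : ℤ, ‖u (γ + m)‖ₑ ^ 2 ≠ ⊤ := by
  have h1 : ∀ᵐ γ ∂(volume.restrict (Set.Ioc (0 : ℝ) 1)), ∑' m : ℤ, ‖u (γ + m)‖ₑ ^ 2 ≠ ⊤ := by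
    have := ae_lt_top' (μ := volume.restrict (Set.Ioc (0 : ℝ) 1))
      (f := fun γ : ℝ => ∑' m : ℤ, ‖u (γ + m)‖ₑ ^ 2)
      (AEMeasurable.tsum fun m => (((aemeasurable_enorm_sq hu).comp_quasiMeasurePreserving
        (measurePreserving_add_right volume (m : ℝ)).quasiMeasurePreserving).restrict))
      (by rw [lintegral_periodize_zero (aemeasurable_enorm_sq hu)]; exact lintegral_enorm_sq_ne_top hu)
    filter_upwards [this] with γ h using h.ne
  rw [ae_restrict_iff' measurableSet_Ioc] at h1
  have h2 : ∀ᵐ γ : ℝ, ∀ n : ℤ, (γ + n) ∈ Set.Ioc (0 : ℝ) 1 →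
    ∑' m : ℤ, ‖u (γ + n + m)‖ₑ ^ 2 ≠ ⊤ := ae_add_int h1
  filter_upwards [h2] with γ h
  -- Translation by `-(⌈γ⌉ - 1)` brings `γ` into `(0, 1]`, and reindexing shows that the
  -- periodization does not change.
  have h3 := h (-(⌈γ⌉ - 1)) ⟨by push_cast; linarith [Int.ceil_lt_add_one γ],
    by push_cast; linarith [Int.le_ceil γ]⟩
  have h4 := (Equiv.addLeft (-(⌈γ⌉ - 1))).tsum_eq fun m : ℤ => ‖u (γ + m)‖ₑ ^ 2
  rw [← h4]
  convert h3 using 5 with m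
  simp
  ring_nf

theorem enorm_bracket_sq_le {u v : ℝ → ℂ} {C : ENNReal}
    (hv : ∀ γ : ℝ, ∑' m : ℤ, ‖v (γ + m)‖ₑ ^ 2 ≤ C) (γ : ℝ) :
    ‖bracket u v γ‖ₑ ^ 2 ≤ (∑' m : ℤ, ‖u (γ + m)‖ₑ ^ 2) * C :=
  (enorm_tsum_mul_sq_le _ _).trans (mul_le_mul_right (hv γ) _)

theorem lintegral_bracket_le {u v : ℝ → ℂ} (hu : MemLp u 2 volume) {C : ENNReal} (hC : C ≠ ⊤)
    (hv : ∀ γ : ℝ, ∑' m : ℤ, ‖v (γ + m)‖ₑ ^ 2 ≤ C) :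
    ∫⁻ γ in Set.Ioc (0 : ℝ) 1, ‖bracket u v γ‖ₑ ^ 2 ≤ (∫⁻ γ, ‖u γ‖ₑ ^ 2) * C := by
  rw [← lintegral_periodize_zero (aemeasurable_enorm_sq hu), ← lintegral_mul_const' _ _ hC]
  exact lintegral_mono fun γ => enorm_bracket_sq_le hv γ

theorem ae_summable_bracket {u v : ℝ → ℂ} (hu : MemLp u 2 volume)
    {C : ENNReal} (hC : C ≠ ⊤)
    (hv : ∀ γ : ℝ, ∑' m : ℤ, ‖v (γ + m)‖ₑ ^ 2 ≤ C) :
    ∀ᵐ γ : ℝ, Summable fun m : ℤ => (starRingEnd ℂ) (u (γ + m)) * v (γ + m) := by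
  filter_upwards [ae_tsum_enorm_sq_ne_top hu] with γ h
  exact summable_conj_mul h ((hv γ).trans_lt hC.lt_top).ne

theorem aestronglyMeasurable_comp_add_int {f : ℝ → ℂ} (hf : AEStronglyMeasurable f volume) (m : ℤ) :
    AEStronglyMeasurable (fun γ : ℝ => f (γ + m)) volume :=
  hf.comp_quasiMeasurePreserving
    (measurePreserving_add_right volume (m : ℝ)).quasiMeasurePreserving

theorem aestronglyMeasurable_bracket {u v : ℝ → ℂ} (hu : MemLp u 2 volume)
    (hv' : AEStronglyMeasurable v volume) {C : ENNReal} (hC : C ≠ ⊤)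
    (hv : ∀ γ : ℝ, ∑' m : ℤ, ‖v (γ + m)‖ₑ ^ 2 ≤ C) :
    AEStronglyMeasurable (bracket u v) volume := by
  refine aestronglyMeasurable_of_tendsto_ae (u := (Filter.atTop : Filter (Finset ℤ)))
    (f := fun s γ => ∑ m ∈ s, (starRingEnd ℂ) (u (γ + (m : ℤ))) * v (γ + (m : ℤ))) (fun s => ?_) ?_
  · refine Finset.aestronglyMeasurable_fun_sum _ fun m _ => ?_
    exact (Complex.continuous_conj.comp_aestronglyMeasurable
      (aestronglyMeasurable_comp_add_int hu.1 m)).mul (aestronglyMeasurable_comp_add_int hv' m)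
  · filter_upwards [ae_summable_bracket hu hC hv] with γ h using h.hasSum

/-- For integer `k` the character is 1-periodic, so cutting the line into unit intervals turns the
integral into a Fourier coefficient of the periodization. -/
theorem integral_character_mul_eq {w : ℝ → ℂ} (hw : Integrable w volume) (k : ℤ) :
    ∫ γ : ℝ, Complex.exp (-2 * Real.pi * Complex.I * (k : ℝ) * γ) * w γ =
      ∫ γ in Set.Ioc (0 : ℝ) 1, Complex.exp (-2 * Real.pi * Complex.I * (k : ℝ) * γ) *
        ∑' m : ℤ, w (γ + m) := by
  set g : ℝ → ℂ := fun γ => Complex.exp (-2 * Real.pi * Complex.I * (k : ℝ) * γ) * w γ with hg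
  have hgi : Integrable g volume := by
    refine hw.congr' ((Continuous.aestronglyMeasurable (by fun_prop)).mul hw.1)
      (Filter.Eventually.of_forall fun γ => ?_)
    rw [hg, norm_mul, norm_character, one_mul]
  have hper : ∀ (γ : ℝ) (m : ℤ), Complex.exp (-2 * Real.pi * Complex.I * (k : ℝ) * γ) * w (γ + m)
      = g (γ + m) := by
    intro γ m
    have h : (-2 * Real.pi * Complex.I * (k : ℝ) * ((γ + m : ℝ) : ℂ) : ℂ)
        = -2 * Real.pi * Complex.I * (k : ℝ) * γ + ((-(k * m) : ℤ) : ℂ) * (2 * Real.pi * Complex.I) := by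
      push_cast; ring
    rw [hg]
    simp only
    rw [h, Complex.exp_periodic.int_mul]
  simp_rw [← tsum_mul_left, hper]
  rw [integral_tsum]
  · rw [← hgi.hasSum_intervalIntegral_comp_add_int.tsum_eq]
    refine tsum_congr fun m => ?_
    rw [intervalIntegral.integral_of_le zero_le_one]
  · exact fun m => (aestronglyMeasurable_comp_add_int hgi.1 m).restrict
  · have h1 : ∀ m : ℤ, AEMeasurable (fun γ : ℝ => ‖g (γ + m)‖ₑ) (volume.restrict (Set.Ioc 0 1)) :=
      fun m => ((aestronglyMeasurable_comp_add_int hgi.1 m).restrict).enorm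
    rw [← lintegral_tsum h1, lintegral_periodize_zero hgi.1.enorm]
    exact hgi.2.ne

/-- Parseval's identity for the bracket product. -/
theorem tsum_enorm_sq_integral_character_mul {u v : ℝ → ℂ} (hu : MemLp u 2 volume)
    (hv' : MemLp v 2 volume) {C : ENNReal} (hC : C ≠ ⊤)
    (hv : ∀ γ : ℝ, ∑' m : ℤ, ‖v (γ + m)‖ₑ ^ 2 ≤ C) :
    ∑' k : ℤ, ‖∫ γ : ℝ, Complex.exp (-2 * Real.pi * Complex.I * (k : ℝ) * γ) *
      ((starRingEnd ℂ) (u γ) * v γ)‖ₑ ^ 2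
      = ∫⁻ γ in Set.Ioc (0 : ℝ) 1, ‖bracket u v γ‖ₑ ^ 2 := by
  have hw : Integrable (fun γ => (starRingEnd ℂ) (u γ) * v γ) volume :=
    MemLp.integrable_mul (p := 2) (q := 2) hu.star hv'
  have hfin : ∫⁻ γ in Set.Ioc (0 : ℝ) 1, ‖bracket u v γ‖ₑ ^ 2 ≠ ⊤ :=
    ((lintegral_bracket_le hu hC hv).trans_lt
      (ENNReal.mul_lt_top (lintegral_enorm_sq_ne_top hu).lt_top hC.lt_top)).ne
  have hB : MemLp (bracket u v) 2 (volume.restrict (Set.Ioc (0 : ℝ) 1)) := by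
    refine ⟨(aestronglyMeasurable_bracket hu hv'.1 hC hv).restrict, ?_⟩
    rw [eLpNorm_lt_top_iff_lintegral_rpow_enorm_lt_top two_ne_zero ENNReal.ofNat_ne_top]
    simpa using hfin.lt_top
  have h := hasSum_sq_fourierCoeffOn zero_lt_one hB
  have hcoef : ∀ k : ℤ, fourierCoeffOn zero_lt_one (bracket u v) k
      = ∫ γ : ℝ, Complex.exp (-2 * Real.pi * Complex.I * (k : ℝ) * γ) *
      ((starRingEnd ℂ) (u γ) * v γ) := by
    intro k
    rw [integral_character_mul_eq hw, fourierCoeffOn_eq_integral,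
      intervalIntegral.integral_of_le zero_le_one, sub_zero, one_div_one, one_smul]
    refine integral_congr_ae (Filter.Eventually.of_forall fun γ => ?_)
    simp only [smul_eq_mul, bracket, fourier_coe_apply]
    congr 2
    push_cast; ring
  simp_rw [hcoef] at h
  have h2 : ∫⁻ γ in Set.Ioc (0 : ℝ) 1, ‖bracket u v γ‖ₑ ^ 2
      = ENNReal.ofReal (∫ γ in (0 : ℝ)..1, ‖bracket u v γ‖ ^ 2) := by
    rw [intervalIntegral.integral_of_le zero_le_one, ofReal_integral_eq_lintegral_ofReal]
    · refine lintegral_congr fun γ => ?_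
      rw [ENNReal.ofReal_pow (norm_nonneg _), ofReal_norm]
    · exact hB.integrable_norm_pow two_ne_zero
    · exact Filter.Eventually.of_forall fun γ => by positivity
  rw [h2]
  rw [sub_zero, inv_one, one_smul] at h
  rw [← h.tsum_eq, ENNReal.ofReal_tsum_of_nonneg (fun _ => by positivity) h.summable]
  refine tsum_congr fun k => ?_
  rw [ENNReal.ofReal_pow (norm_nonneg _), ofReal_norm]

/-! ### The two-scale identity of the unitary extension principle -/

/-- Halving sends `γ + m` to a translate of `γ/2` or of `γ/2 + 1/2` according to the parity of `m`;
a 1-periodic filter is constant on each class. -/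
theorem hasSum_int_even_add_odd {M : Type*} [AddCommMonoid M] [TopologicalSpace M] [ContinuousAdd M]
    {f : ℤ → M} {a b : M} (he : HasSum (fun k => f (2 * k)) a)
    (ho : HasSum (fun k => f (2 * k + 1)) b) : HasSum f (a + b) := by
  have := mul_right_injective₀ (two_ne_zero' ℤ)
  replace ho := ((add_left_injective 1).comp this).hasSum_range_iff.2 ho
  refine (this.hasSum_range_iff.2 he).add_isCompl ?_ ho
  simpa [Function.comp_def] using Int.isCompl_even_odd

theorem setLIntegral_comp_half (F : ℝ → ENNReal) (t : Set ℝ) :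
    ∫⁻ x in (fun x : ℝ => 2⁻¹ * x) ⁻¹' t, F (2⁻¹ * x) = 2 * ∫⁻ x in t, F x := by
  have he : MeasurableEmbedding (fun x : ℝ => 2⁻¹ * x) :=
    (Homeomorph.mulLeft₀ (2⁻¹ : ℝ) (by norm_num)).measurableEmbedding
  have hm : Measure.map (fun x : ℝ => 2⁻¹ * x) volume = (2 : ENNReal) • volume := by
    rw [Real.map_volume_mul_left (by norm_num)]
    norm_num
  rw [← he.lintegral_map, ← he.restrict_map, hm, Measure.restrict_smul, lintegral_smul_measure,
    smul_eq_mul]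

/-- The maps `x/2` and `x/2 + 1/2` carry the period onto its two halves, each with Jacobian factor
2. -/
theorem setLIntegral_half_add_half (F : ℝ → ENNReal) (hF : AEMeasurable F volume) :
    ∫⁻ x in Set.Ioc (0 : ℝ) 1, (F (2⁻¹ * x) + F (2⁻¹ * x + 1 / 2))
      = 2 * ∫⁻ x in Set.Ioc (0 : ℝ) 1, F x := by
  have hq : Measure.QuasiMeasurePreserving (fun x : ℝ => 2⁻¹ * x) volume volume :=
    Measure.quasiMeasurePreserving_smul volume (by norm_num : (2⁻¹ : ℝ) ≠ 0)
  have h1 : ∫⁻ x in Set.Ioc (0 : ℝ) 1, F (2⁻¹ * x) = 2 * ∫⁻ x in Set.Ioc (0 : ℝ) (1 / 2), F x := by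
    rw [← setLIntegral_comp_half]
    congr 2
    rw [Set.preimage_const_mul_Ioc₀ _ _ (by norm_num)]
    norm_num
  have h2 : ∫⁻ x in Set.Ioc (0 : ℝ) 1, F (2⁻¹ * x + 1 / 2)
      = 2 * ∫⁻ x in Set.Ioc (1 / 2 : ℝ) 1, F x := by
    have h3 := (measurePreserving_add_right volume (1 / 2 : ℝ)).setLIntegral_comp_preimage_emb
      (measurableEmbedding_addRight (1 / 2 : ℝ)) F (Set.Ioc (1 / 2 : ℝ) 1)
    rw [← h3, ← setLIntegral_comp_half (fun x => F (x + 1 / 2))]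
    congr 2
    rw [Set.preimage_add_const_Ioc, Set.preimage_const_mul_Ioc₀ _ _ (by norm_num)]
    norm_num
  have hF' : AEMeasurable (fun x => F (2⁻¹ * x)) volume := hF.comp_quasiMeasurePreserving hq
  rw [lintegral_add_left' hF'.restrict, h1, h2, ← mul_add,
    ← Set.Ioc_union_Ioc_eq_Ioc (by norm_num : (0 : ℝ) ≤ 1 / 2) (by norm_num : (1 / 2 : ℝ) ≤ 1),
    lintegral_union measurableSet_Ioc (Set.Ioc_disjoint_Ioc_of_le le_rfl)]

/-- The identities between filters required by the unitary extension principle. -/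
structure IsExtensionFilter {N : ℕ} (m₀ : ℝ → ℂ) (H : Fin N → ℝ → ℂ) : Prop where
  periodic_lowpass : Function.Periodic m₀ 1
  periodic : ∀ n, Function.Periodic (H n) 1
  aestronglyMeasurable : ∀ n, AEStronglyMeasurable (H n) volume
  sum_sq : ∀ γ, ‖m₀ γ‖ ^ 2 + ∑ n, ‖H n γ‖ ^ 2 = 1
  sum_cross : ∀ γ, m₀ γ * (starRingEnd ℂ) (m₀ (γ + 1 / 2))
    + ∑ n, H n γ * (starRingEnd ℂ) (H n (γ + 1 / 2)) = 0

/-- A function satisfying a refinement equation whose integer translates generate a Bessel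
sequence. -/
structure IsRefinable (m₀ : ℝ → ℂ) (Φ : ℝ → ℂ) : Prop where
  memLp : MemLp Φ 2 volume
  sum_sq_le : ∀ γ : ℝ, ∑' m : ℤ, ‖Φ (γ + m)‖ₑ ^ 2 ≤ 1
  refinement : ∀ γ, Φ γ = m₀ (2⁻¹ * γ) * Φ (2⁻¹ * γ)

/-- The function `γ ↦ h(γ/2) Φ(γ/2)`. -/
def filtered (h Φ : ℝ → ℂ) (γ : ℝ) : ℂ := h (2⁻¹ * γ) * Φ (2⁻¹ * γ)

theorem filtered_even {h : ℝ → ℂ} (hh : Function.Periodic h 1) (Φ : ℝ → ℂ) (γ : ℝ) (m : ℤ) :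
    filtered h Φ (γ + (2 * m : ℤ)) = h (2⁻¹ * γ) * Φ (2⁻¹ * γ + m) := by
  have : 2⁻¹ * (γ + (2 * m : ℤ)) = 2⁻¹ * γ + m := by push_cast; ring
  have h2 := hh.int_mul m (2⁻¹ * γ)
  rw [mul_one] at h2
  rw [filtered, this, h2]

theorem filtered_odd {h : ℝ → ℂ} (hh : Function.Periodic h 1) (Φ : ℝ → ℂ) (γ : ℝ) (m : ℤ) :
    filtered h Φ (γ + (2 * m + 1 : ℤ)) = h (2⁻¹ * γ + 1 / 2) * Φ (2⁻¹ * γ + 1 / 2 + m) := by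
  have : 2⁻¹ * (γ + (2 * m + 1 : ℤ)) = 2⁻¹ * γ + 1 / 2 + m := by push_cast; ring
  have h2 := hh.int_mul m (2⁻¹ * γ + 1 / 2)
  rw [mul_one] at h2
  rw [filtered, this, h2]

theorem tsum_filtered_enorm_sq_le {h Φ : ℝ → ℂ} (hh : Function.Periodic h 1) (h1 : ∀ γ, ‖h γ‖ ≤ 1)
    (hΦ : ∀ γ : ℝ, ∑' m : ℤ, ‖Φ (γ + m)‖ₑ ^ 2 ≤ 1) (γ : ℝ) :
    ∑' m : ℤ, ‖filtered h Φ (γ + m)‖ₑ ^ 2 ≤ 2 := by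
  have key : ∀ ξ : ℝ, ∑' m : ℤ, ‖h ξ * Φ (ξ + m)‖ₑ ^ 2 ≤ 1 := by
    intro ξ
    refine le_trans (ENNReal.tsum_le_tsum fun m => ?_) (hΦ ξ)
    rw [enorm_mul, mul_pow]
    refine mul_le_of_le_one_left zero_le (pow_le_one₀ zero_le ?_)
    rw [← ofReal_norm]
    exact ENNReal.ofReal_le_one.2 (h1 ξ)
  have hs := hasSum_int_even_add_odd (f := fun m : ℤ => ‖filtered h Φ (γ + m)‖ₑ ^ 2)
    ENNReal.summable.hasSum ENNReal.summable.hasSum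
  rw [hs.tsum_eq]
  simp_rw [filtered_even hh, filtered_odd hh]
  exact (add_le_add (key _) (key _)).trans one_add_one_eq_two.le

theorem quasiMeasurePreserving_mul {a : ℝ} (ha : a ≠ 0) :
    Measure.QuasiMeasurePreserving (fun x : ℝ => a * x) volume volume :=
  Measure.quasiMeasurePreserving_smul volume ha

theorem memLp_comp_mul {a : ℝ} (ha : 0 < a) {f : ℝ → ℂ} (hf : MemLp f 2 volume) :
    MemLp (fun x => f (a * x)) 2 volume := by
  have h := (memLp_dilation ha hf).const_mul ((Real.sqrt a : ℂ)⁻¹)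
  refine h.ae_eq (Filter.Eventually.of_forall fun x => ?_)
  have : (Real.sqrt a : ℂ) ≠ 0 := by
    simpa using (Real.sqrt_pos.2 ha).ne'
  simp [this]

theorem memLp_filtered {h Φ : ℝ → ℂ} (hm : AEStronglyMeasurable h volume) (h1 : ∀ γ, ‖h γ‖ ≤ 1)
    (hΦ : MemLp Φ 2 volume) : MemLp (filtered h Φ) 2 volume := by
  have h2 := memLp_comp_mul (inv_pos.2 two_pos) hΦ
  refine h2.mono ((hm.comp_quasiMeasurePreserving
    (quasiMeasurePreserving_mul (by norm_num))).mul h2.1) (Filter.Eventually.of_forall fun γ => ?_)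
  rw [filtered, norm_mul]
  exact mul_le_of_le_one_left (norm_nonneg _) (h1 _)

theorem bracket_filtered {u h Φ : ℝ → ℂ} (hh : Function.Periodic h 1) {γ : ℝ}
    (h1 : Summable fun m : ℤ => (starRingEnd ℂ) (u (2 * (2⁻¹ * γ + m))) * Φ (2⁻¹ * γ + m))
    (h2 : Summable fun m : ℤ =>
      (starRingEnd ℂ) (u (2 * (2⁻¹ * γ + 1 / 2 + m))) * Φ (2⁻¹ * γ + 1 / 2 + m)) :
    bracket u (filtered h Φ) γ = h (2⁻¹ * γ) * bracket (fun x => u (2 * x)) Φ (2⁻¹ * γ) +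
      h (2⁻¹ * γ + 1 / 2) * bracket (fun x => u (2 * x)) Φ (2⁻¹ * γ + 1 / 2) := by
  refine (hasSum_int_even_add_odd ?_ ?_).tsum_eq
  · refine (h1.hasSum.mul_left (h (2⁻¹ * γ))).congr_fun fun m => ?_
    rw [filtered_even hh]
    have : 2 * (2⁻¹ * γ + m) = γ + (2 * m : ℤ) := by push_cast; ring
    rw [this]; ring
  · refine (h2.hasSum.mul_left (h (2⁻¹ * γ + 1 / 2))).congr_fun fun m => ?_
    rw [filtered_odd hh]
    have : 2 * (2⁻¹ * γ + 1 / 2 + m) = γ + (2 * m + 1 : ℤ) := by push_cast; ring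
    rw [this]; ring

namespace IsExtensionFilter

variable {N : ℕ} {m₀ : ℝ → ℂ} {H : Fin N → ℝ → ℂ}

theorem norm_le_one (hF : IsExtensionFilter m₀ H) (n : Fin N) (γ : ℝ) : ‖H n γ‖ ≤ 1 := by
  have h1 := hF.sum_sq γ
  have h2 := Finset.single_le_sum (f := fun n => ‖H n γ‖ ^ 2) (fun _ _ => by positivity)
    (Finset.mem_univ n)
  nlinarith [sq_nonneg ‖m₀ γ‖, norm_nonneg (H n γ)]

/-- `sum_sq` at `γ` and at `γ + 1/2`, with `sum_cross`, says that two vectors in `ℂ^(N+1)` are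
orthonormal; this is Pythagoras for their combination. -/
theorem sum_sq_combination (hF : IsExtensionFilter m₀ H) (γ : ℝ) (b b' : ℂ) :
    ‖m₀ γ * b + m₀ (γ + 1 / 2) * b'‖ ^ 2 + ∑ n, ‖H n γ * b + H n (γ + 1 / 2) * b'‖ ^ 2
      = ‖b‖ ^ 2 + ‖b'‖ ^ 2 := by
  have key : ∀ x x' : ℂ, ‖x * b + x' * b'‖ ^ 2 = ‖x‖ ^ 2 * ‖b‖ ^ 2 + ‖x'‖ ^ 2 * ‖b'‖ ^ 2
      + 2 * ((x * (starRingEnd ℂ) x') * (b * (starRingEnd ℂ) b')).re := by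
    intro x x'
    simp only [← Complex.normSq_eq_norm_sq, Complex.normSq_add, map_mul]
    congr 3
    ring
  simp_rw [key, Finset.sum_add_distrib, ← Finset.sum_mul, ← Finset.mul_sum, ← Complex.re_sum,
    ← Finset.sum_mul]
  have h1 := hF.sum_sq γ
  have h2 := hF.sum_sq (γ + 1 / 2)
  have h3 := congrArg (fun w => (w * (b * (starRingEnd ℂ) b')).re) (hF.sum_cross γ)
  simp only [add_mul, Complex.add_re, zero_mul, Complex.zero_re] at h3
  linear_combination ‖b‖ ^ 2 * h1 + ‖b'‖ ^ 2 * h2 + 2 * h3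

theorem sum_enorm_sq_combination (hF : IsExtensionFilter m₀ H) (γ : ℝ) (b b' : ℂ) :
    ‖m₀ γ * b + m₀ (γ + 1 / 2) * b'‖ₑ ^ 2 + ∑ n, ‖H n γ * b + H n (γ + 1 / 2) * b'‖ₑ ^ 2
      = ‖b‖ₑ ^ 2 + ‖b'‖ₑ ^ 2 := by
  have e : ∀ x : ℂ, ‖x‖ₑ ^ 2 = ENNReal.ofReal (‖x‖ ^ 2) := fun x => by
    rw [ENNReal.ofReal_pow (norm_nonneg _), ofReal_norm]
  simp_rw [e]
  rw [← ENNReal.ofReal_sum_of_nonneg (fun _ _ => by positivity),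
    ← ENNReal.ofReal_add (by positivity) (Finset.sum_nonneg fun _ _ => by positivity),
    ← ENNReal.ofReal_add (by positivity) (by positivity), hF.sum_sq_combination]

/-- Each bracket at `γ` combines the same two numbers, the brackets of `u(2·)` and `Φ` at `γ/2` and
`γ/2 + 1/2`, with filter values as coefficients. Orthonormality gives the identity pointwise, before
integration. -/
theorem lintegral_bracket_refine (hF : IsExtensionFilter m₀ H) {u Φ : ℝ → ℂ}
    (hΦ : IsRefinable m₀ Φ) (hu : MemLp u 2 volume) :
    (∫⁻ γ in Set.Ioc (0 : ℝ) 1, ‖bracket u Φ γ‖ₑ ^ 2)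
      + ∑ n, ∫⁻ γ in Set.Ioc (0 : ℝ) 1, ‖bracket u (filtered (H n) Φ) γ‖ₑ ^ 2
      = 2 * ∫⁻ γ in Set.Ioc (0 : ℝ) 1, ‖bracket (fun x => u (2 * x)) Φ γ‖ₑ ^ 2 := by
  have hu2 := memLp_comp_mul two_pos hu
  have hB := aestronglyMeasurable_bracket hu2 hΦ.memLp.1 ENNReal.one_ne_top hΦ.sum_sq_le
  have hm : ∀ n, AEMeasurable (fun γ => ‖bracket u (filtered (H n) Φ) γ‖ₑ ^ 2)
      (volume.restrict (Set.Ioc (0 : ℝ) 1)) := fun n =>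
    ((aestronglyMeasurable_bracket hu (memLp_filtered (hF.aestronglyMeasurable n)
      (hF.norm_le_one n) hΦ.memLp).1 ENNReal.ofNat_ne_top (tsum_filtered_enorm_sq_le (hF.periodic n)
      (hF.norm_le_one n) hΦ.sum_sq_le)).enorm.pow_const 2).restrict
  rw [← lintegral_finsetSum' _ fun n _ => hm n,
    ← lintegral_add_right' _ (Finset.aemeasurable_fun_sum _ fun n _ => hm n),
    ← setLIntegral_half_add_half _ (hB.enorm.pow_const 2)]
  refine lintegral_congr_ae (ae_restrict_of_ae ?_)
  have hs := ae_summable_bracket hu2 ENNReal.one_ne_top hΦ.sum_sq_le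
  have hs2 : ∀ᵐ x : ℝ, Summable fun m : ℤ =>
      (starRingEnd ℂ) (u (2 * (x + 1 / 2 + m))) * Φ (x + 1 / 2 + m) :=
    (measurePreserving_add_right volume (1 / 2 : ℝ)).quasiMeasurePreserving.ae hs
  filter_upwards [ae_mul_left (inv_pos.2 two_pos) hs, ae_mul_left (inv_pos.2 two_pos) hs2]
    with γ h1 h2
  -- The refinement equation puts the low-pass term in the same form as the others.
  have h0 : bracket u Φ γ = bracket u (filtered m₀ Φ) γ := by
    rw [show filtered m₀ Φ = Φ from funext fun x => (hΦ.refinement x).symm]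
  simp_rw [h0, bracket_filtered hF.periodic_lowpass h1 h2, bracket_filtered (hF.periodic _) h1 h2]
  exact hF.sum_enorm_sq_combination _ _ _

end IsExtensionFilter

/-- The energy `∑_k |⟨g, T_k φ⟩|²`. -/
def shiftEnergy (φ g : L2R) : ENNReal := ∑' k : ℤ, ‖inner ℂ g (translation (k : ℝ) φ)‖ₑ ^ 2

theorem shiftEnergy_eq {φ g : L2R} {u v : ℝ → ℂ} (hu : (𝓕 g : L2R) =ᵐ[volume] u)
    (hv : (𝓕 φ : L2R) =ᵐ[volume] v) {C : ENNReal} (hC : C ≠ ⊤)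
    (hv1 : ∀ γ : ℝ, ∑' m : ℤ, ‖v (γ + m)‖ₑ ^ 2 ≤ C) :
    shiftEnergy φ g = ∫⁻ γ in Set.Ioc (0 : ℝ) 1, ‖bracket u v γ‖ₑ ^ 2 := by
  rw [← tsum_enorm_sq_integral_character_mul ((Lp.memLp _).ae_eq hu) ((Lp.memLp _).ae_eq hv) hC hv1]
  refine tsum_congr fun k => ?_
  rw [inner_translation_eq g φ hu hv]

theorem ae_eq_filtered_of_generated {h : ℝ → ℂ} {Φ : ℝ → ℂ} {φ ψ : L2R}
    (hφ : (𝓕 φ : L2R) =ᵐ[volume] Φ)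
    (hψ : ∀ᵐ γ : ℝ, (𝓕 ψ : L2R) (2 * γ) = h γ * (𝓕 φ : L2R) γ) :
    (𝓕 ψ : L2R) =ᵐ[volume] filtered h Φ := by
  have h1 : ∀ᵐ γ : ℝ, (𝓕 ψ : L2R) (2 * γ) = h γ * Φ γ := by
    filter_upwards [hψ, hφ] with γ e1 e2
    rw [e1, e2]
  filter_upwards [ae_mul_left (inv_pos.2 two_pos) h1] with γ h2
  rwa [mul_inv_cancel_left₀ two_ne_zero] at h2

/-- One step of the decomposition across scales; the factor 2 of `lintegral_bracket_refine` is the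
square of the `√2` in `D`. -/
theorem shiftEnergy_dilation_symm {N : ℕ} {m₀ : ℝ → ℂ} {H : Fin N → ℝ → ℂ} {Φ : ℝ → ℂ}
    (hF : IsExtensionFilter m₀ H) (hΦ : IsRefinable m₀ Φ) {φ : L2R} {ψ : Fin N → L2R}
    (hφ : (𝓕 φ : L2R) =ᵐ[volume] Φ) (hψ : IsGeneratedBy H φ ψ) (g : L2R) :
    shiftEnergy φ (dilation.symm g) = shiftEnergy φ g + ∑ n, shiftEnergy (ψ n) g := by
  have hn : ∀ n, shiftEnergy (ψ n) g = ∫⁻ γ in Set.Ioc (0 : ℝ) 1,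
      ‖bracket (𝓕 g : L2R) (filtered (H n) Φ) γ‖ₑ ^ 2 := fun n =>
    shiftEnergy_eq Filter.EventuallyEq.rfl (ae_eq_filtered_of_generated hφ (hψ n))
      ENNReal.ofNat_ne_top (tsum_filtered_enorm_sq_le (hF.periodic n) (hF.norm_le_one n)
        hΦ.sum_sq_le)
  simp_rw [hn]
  rw [shiftEnergy_eq (fourier_dilation_symm_ae g) hφ ENNReal.one_ne_top hΦ.sum_sq_le,
    shiftEnergy_eq Filter.EventuallyEq.rfl hφ ENNReal.one_ne_top hΦ.sum_sq_le,
    hF.lintegral_bracket_refine hΦ (Lp.memLp _), ← lintegral_const_mul' _ _ ENNReal.ofNat_ne_top]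
  refine lintegral_congr fun γ => ?_
  have : bracket (fun γ => (Real.sqrt 2 : ℂ) * (𝓕 g : L2R) (2 * γ)) Φ γ
      = (Real.sqrt 2 : ℂ) * bracket (fun γ => (𝓕 g : L2R) (2 * γ)) Φ γ := by
    simp_rw [bracket, ← tsum_mul_left, map_mul, Complex.conj_ofReal, mul_assoc]
  rw [this, enorm_mul, mul_pow]
  congr 1
  rw [← ofReal_norm, Complex.norm_real, Real.norm_of_nonneg (Real.sqrt_nonneg 2),
    ← ENNReal.ofReal_pow (Real.sqrt_nonneg 2), Real.sq_sqrt zero_le_two, ENNReal.ofReal_ofNat]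

/-! ### The energies of dilates -/

theorem lintegral_enorm_sq_coeFn (f : L2R) : ∫⁻ x, ‖f x‖ₑ ^ 2 = ‖f‖ₑ ^ 2 := by
  have h := eLpNorm_nnreal_pow_eq_lintegral (f := (f : ℝ → ℂ)) (p := 2) (μ := volume) two_ne_zero
  simp only [NNReal.coe_ofNat, ENNReal.rpow_ofNat, ENNReal.coe_ofNat] at h
  rw [Lp.enorm_def, h]

theorem lintegral_comp_mul_left {a : ℝ} (ha : 0 < a) (F : ℝ → ENNReal) :
    ∫⁻ x, F (a * x) = ENNReal.ofReal a⁻¹ * ∫⁻ x, F x := by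
  have he : MeasurableEmbedding (fun x : ℝ => a * x) :=
    (Homeomorph.mulLeft₀ a ha.ne').measurableEmbedding
  rw [← he.lintegral_map, Real.map_volume_mul_left ha.ne', abs_of_pos (inv_pos.2 ha),
    lintegral_smul_measure, smul_eq_mul]

theorem shiftEnergy_le {m₀ Φ : ℝ → ℂ} (hΦ : IsRefinable m₀ Φ) {φ : L2R}
    (hφ : (𝓕 φ : L2R) =ᵐ[volume] Φ) (g : L2R) : shiftEnergy φ g ≤ ‖g‖ₑ ^ 2 := by
  rw [shiftEnergy_eq Filter.EventuallyEq.rfl hφ ENNReal.one_ne_top hΦ.sum_sq_le]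
  refine (lintegral_bracket_le (Lp.memLp _) ENNReal.one_ne_top hΦ.sum_sq_le).trans ?_
  rw [mul_one, lintegral_enorm_sq_coeFn, ← ofReal_norm, Lp.norm_fourier_eq, ofReal_norm]

/-- The square root of the energy `∑_k |⟨g, T_k φ⟩|²`. -/
def shiftNorm (φ g : L2R) : ℝ :=
  (eLpNorm (fun k : ℤ => inner ℂ g (translation (k : ℝ) φ)) 2 Measure.count).toReal

theorem eLpNorm_sq_eq_shiftEnergy (φ g : L2R) :
    eLpNorm (fun k : ℤ => inner ℂ g (translation (k : ℝ) φ)) 2 Measure.count ^ 2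
      = shiftEnergy φ g := by
  have h := eLpNorm_nnreal_pow_eq_lintegral (f := fun k : ℤ => inner ℂ g (translation (k : ℝ) φ))
    (p := 2) (μ := Measure.count) two_ne_zero
  simp only [NNReal.coe_ofNat, ENNReal.rpow_ofNat, ENNReal.coe_ofNat, lintegral_count] at h
  exact h

theorem shiftNorm_sq (φ g : L2R) : shiftNorm φ g ^ 2 = (shiftEnergy φ g).toReal := by
  rw [shiftNorm, ← ENNReal.toReal_pow, eLpNorm_sq_eq_shiftEnergy]

theorem shiftNorm_nonneg (φ g : L2R) : 0 ≤ shiftNorm φ g := ENNReal.toReal_nonneg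

theorem shiftNorm_eq_sqrt (φ g : L2R) : shiftNorm φ g = Real.sqrt (shiftEnergy φ g).toReal := by
  rw [← shiftNorm_sq, Real.sqrt_sq (shiftNorm_nonneg _ _)]

/-- `shiftNorm φ` is the `ℓ²` norm of an additive map of bound 1, hence 1-Lipschitz. Limits along
scales thus need checking only on a dense set. -/
theorem abs_shiftNorm_sub_le {φ : L2R} (hb : ∀ g, shiftEnergy φ g ≤ ‖g‖ₑ ^ 2) (f g : L2R) :
    |shiftNorm φ f - shiftNorm φ g| ≤ ‖f - g‖ := by
  have hb' : ∀ g, eLpNorm (fun k : ℤ => inner ℂ g (translation (k : ℝ) φ)) 2 Measure.count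
      ≤ ‖g‖ₑ := by
    intro g
    have h := hb g
    rw [← eLpNorm_sq_eq_shiftEnergy] at h
    exact (ENNReal.pow_le_pow_left_iff two_ne_zero).1 h
  have key : ∀ f g : L2R, shiftNorm φ f ≤ shiftNorm φ g + ‖f - g‖ := by
    intro f g
    have h1 : (fun k : ℤ => inner ℂ f (translation (k : ℝ) φ))
        = (fun k : ℤ => inner ℂ g (translation (k : ℝ) φ))
          + fun k : ℤ => inner ℂ (f - g) (translation (k : ℝ) φ) := by
      funext k
      rw [Pi.add_apply, ← inner_add_left, add_sub_cancel]
    have h2 : eLpNorm (fun k : ℤ => inner ℂ f (translation (k : ℝ) φ)) 2 Measure.count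
        ≤ eLpNorm (fun k : ℤ => inner ℂ g (translation (k : ℝ) φ)) 2 Measure.count + ‖f - g‖ₑ := by
      rw [h1]
      refine (eLpNorm_add_le .of_discrete .of_discrete one_le_two).trans ?_
      gcongr
      exact hb' _
    have h3 := ENNReal.toReal_mono (ENNReal.add_ne_top.2
      ⟨((hb' g).trans_lt enorm_lt_top).ne, enorm_lt_top.ne⟩) h2
    rwa [ENNReal.toReal_add ((hb' g).trans_lt enorm_lt_top).ne enorm_lt_top.ne,
      toReal_enorm] at h3
  rw [abs_sub_le_iff]
  constructor
  · linarith [key f g]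
  · have := key g f
    rw [norm_sub_rev] at this
    linarith

theorem tendsto_of_dense {p : ℕ → L2R → ℝ} {q : L2R → ℝ}
    (hp : ∀ J f g, |p J f - p J g| ≤ ‖f - g‖) (hq : ∀ f g, |q f - q g| ≤ ‖f - g‖) {S : Set L2R}
    (hS : ∀ f, ∀ ε > 0, ∃ g ∈ S, ‖f - g‖ < ε)
    (h : ∀ g ∈ S, Filter.Tendsto (fun J => p J g) Filter.atTop (nhds (q g))) (f : L2R) :
    Filter.Tendsto (fun J => p J f) Filter.atTop (nhds (q f)) := by
  rw [Metric.tendsto_atTop]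
  intro ε hε
  obtain ⟨g, hg, hfg⟩ := hS f (ε / 3) (by positivity)
  obtain ⟨M, hM⟩ := Metric.tendsto_atTop.1 (h g hg) (ε / 3) (by positivity)
  refine ⟨M, fun J hJ => ?_⟩
  have h1 := hM J hJ
  rw [Real.dist_eq] at h1 ⊢
  have h2 := hp J f g
  have h3 := hq f g
  rw [abs_le] at h2 h3
  rw [abs_lt] at h1 ⊢
  constructor <;> linarith [h1.1, h1.2, h2.1, h2.2, h3.1, h3.2]

/-- The square-integrable functions of bounded support. -/
def boundedSupport : Set L2R :=
  {g | ∃ (R : ℝ) (u : ℝ → ℂ), g =ᵐ[volume] u ∧ ∀ x, R < |x| → u x = 0}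

theorem exists_boundedSupport (f : L2R) (ε : ℝ) (hε : 0 < ε) :
    ∃ g ∈ boundedSupport, ‖f - g‖ < ε := by
  obtain ⟨g, hg1, hg2, -, hg4⟩ := (Lp.memLp f).exists_hasCompactSupport_eLpNorm_sub_le
    ENNReal.ofNat_ne_top (ε := ENNReal.ofReal (ε / 2)) (by simpa using hε)
  obtain ⟨R, hR⟩ := hg1.isCompact.isBounded.subset_closedBall 0
  refine ⟨hg4.toLp g, ⟨R, g, hg4.coeFn_toLp, fun x hx => ?_⟩, ?_⟩
  · by_contra hne
    have := hR (subset_tsupport g hne)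
    rw [mem_closedBall_zero_iff, Real.norm_eq_abs] at this
    linarith
  · have h1 : f - hg4.toLp g = ((Lp.memLp f).sub hg4).toLp _ := by
      rw [MemLp.toLp_sub (Lp.memLp f) hg4, Lp.toLp_coeFn]
    rw [h1, Lp.norm_toLp]
    refine (ENNReal.toReal_le_of_le_ofReal (by positivity) hg2).trans_lt (by linarith)

theorem coeFn_dilation_pow (J : ℕ) {f : L2R} {u : ℝ → ℂ} (hf : f =ᵐ[volume] u) :
    ((dilation ^ J) f : L2R) =ᵐ[volume] fun x => (Real.sqrt 2 : ℂ) ^ J * u (2 ^ J * x) := by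
  induction J with
  | zero => simpa using hf
  | succ J ih =>
    rw [pow_succ']
    change ((dilation ((dilation ^ J) f) : L2R) : ℝ → ℂ) =ᵐ[volume] _
    filter_upwards [coeFn_dilation ((dilation ^ J) f), ae_mul_left two_pos ih] with x h1 h2
    rw [h1, h2, pow_succ', pow_succ, mul_assoc, mul_assoc]

theorem fourier_dilation_inv_pow (J : ℕ) (f : L2R) :
    𝓕 ((dilation⁻¹ ^ J) f) = (dilation ^ J) (𝓕 f) := by
  induction J with
  | zero => rfl
  | succ J ih =>
    rw [pow_succ', pow_succ']
    change 𝓕 (dilation.symm ((dilation⁻¹ ^ J) f)) = dilation ((dilation ^ J) (𝓕 f))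
    rw [fourier_dilation_symm, ih]

theorem enorm_tsum_sq_eq {f : ℤ → ℂ} (m₀ : ℤ) (h : ∀ m, m ≠ m₀ → f m = 0) :
    ‖∑' m, f m‖ₑ ^ 2 = ∑' m, ‖f m‖ₑ ^ 2 := by
  rw [tsum_eq_single m₀ h, tsum_eq_single m₀ fun m hm => by rw [h m hm]; simp]

/-- The support is shorter than a period, so only `m = -round γ` can contribute and squaring
commutes with the sum. -/
theorem enorm_bracket_sq_eq {u : ℝ → ℂ} {ρ : ℝ} (hρ : 2 * ρ < 1) (hu : ∀ x, ρ < |x| → u x = 0)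
    (v : ℝ → ℂ) (γ : ℝ) :
    ‖bracket u v γ‖ₑ ^ 2 = ∑' m : ℤ, (‖u (γ + m)‖ₑ ^ 2 * ‖v (γ + m)‖ₑ ^ 2) := by
  have h : ‖bracket u v γ‖ₑ ^ 2
      = ∑' m : ℤ, ‖(starRingEnd ℂ) (u (γ + m)) * v (γ + m)‖ₑ ^ 2 := by
    refine enorm_tsum_sq_eq (-round γ) fun m hm => ?_
    rw [hu, map_zero, zero_mul]
    by_contra! hle
    have h1 := abs_sub_round γ
    have h2 : |((m + round γ : ℤ) : ℝ)| < 1 := by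
      push_cast
      calc |(m : ℝ) + round γ| = |(γ + m) - (γ - round γ)| := by ring_nf
        _ ≤ |γ + m| + |γ - round γ| := abs_sub _ _
        _ < 1 := by linarith
    rw [← Int.cast_abs] at h2
    have h3 : |m + round γ| < 1 := by exact_mod_cast h2
    rw [Int.abs_lt_one_iff] at h3
    omega
  rw [h]
  simp_rw [enorm_mul, mul_pow, RCLike.enorm_conj]

namespace IsRefinable

variable {m₀ Φ : ℝ → ℂ}

theorem enorm_le_one (hΦ : IsRefinable m₀ Φ) (γ : ℝ) : ‖Φ γ‖ₑ ^ 2 ≤ 1 := by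
  have := (ENNReal.le_tsum (f := fun m : ℤ => ‖Φ (γ + m)‖ₑ ^ 2) 0).trans (hΦ.sum_sq_le γ)
  simpa using this

/-- Once `R / 2^J < 1/2` there is no aliasing, and a change of variables moves the dilation onto
`Φ`. -/
theorem shiftEnergy_dilation_inv_pow (hΦ : IsRefinable m₀ Φ) {φ : L2R}
    (hφ : (𝓕 φ : L2R) =ᵐ[volume] Φ) {g : L2R} {u : ℝ → ℂ} (hu : (𝓕 g : L2R) =ᵐ[volume] u)
    {R : ℝ} (hR : ∀ x, R < |x| → u x = 0) {J : ℕ} (hJ : 2 * R < 2 ^ J) :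
    shiftEnergy φ ((dilation⁻¹ ^ J) g)
      = ∫⁻ γ, ‖u γ‖ₑ ^ 2 * ‖Φ ((2 ^ J)⁻¹ * γ)‖ₑ ^ 2 := by
  have h2J : (0 : ℝ) < 2 ^ J := by positivity
  have h1 : (𝓕 ((dilation⁻¹ ^ J) g) : L2R) =ᵐ[volume]
      fun x => (Real.sqrt 2 : ℂ) ^ J * u (2 ^ J * x) := by
    rw [fourier_dilation_inv_pow]
    exact coeFn_dilation_pow J hu
  rw [shiftEnergy_eq h1 hφ ENNReal.one_ne_top hΦ.sum_sq_le]
  have h2 : ∀ x, R / 2 ^ J < |x| → (Real.sqrt 2 : ℂ) ^ J * u (2 ^ J * x) = 0 := by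
    intro x hx
    rw [hR, mul_zero]
    rw [abs_mul, abs_of_pos h2J]
    rwa [div_lt_iff₀' h2J] at hx
  have h3 : 2 * (R / 2 ^ J) < 1 := by
    rw [← mul_div_assoc, div_lt_one h2J]; exact hJ
  simp_rw [enorm_bracket_sq_eq h3 h2]
  rw [lintegral_periodize_zero (f := fun x => ‖(Real.sqrt 2 : ℂ) ^ J * u (2 ^ J * x)‖ₑ ^ 2 *
    ‖Φ x‖ₑ ^ 2)]
  · have h4 : ∀ x, ‖(Real.sqrt 2 : ℂ) ^ J * u (2 ^ J * x)‖ₑ ^ 2 * ‖Φ x‖ₑ ^ 2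
        = ENNReal.ofReal (2 ^ J) * (‖u (2 ^ J * x)‖ₑ ^ 2 *
          ‖Φ ((2 ^ J)⁻¹ * (2 ^ J * x))‖ₑ ^ 2) := by
      intro x
      rw [inv_mul_cancel_left₀ h2J.ne', enorm_mul, mul_pow, mul_assoc]
      congr 1
      rw [← ofReal_norm, norm_pow, Complex.norm_real, Real.norm_of_nonneg (Real.sqrt_nonneg 2),
        ← ENNReal.ofReal_pow (by positivity), ← pow_mul, mul_comm J, pow_mul,
        Real.sq_sqrt zero_le_two]
    simp_rw [h4]
    rw [lintegral_const_mul' _ _ ENNReal.ofReal_ne_top,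
      lintegral_comp_mul_left h2J (fun y => ‖u y‖ₑ ^ 2 * ‖Φ ((2 ^ J)⁻¹ * y)‖ₑ ^ 2), ← mul_assoc,
      ← ENNReal.ofReal_mul h2J.le, mul_inv_cancel₀ h2J.ne', ENNReal.ofReal_one, one_mul]
  · exact (((Lp.memLp _).ae_eq h1).1.enorm.pow_const 2).mul (hΦ.memLp.1.enorm.pow_const 2)

/-- Dominated convergence with majorant `|u|²`: the factor `Φ(2^{-J} γ)` is bounded by 1 and tends
to 1. -/
theorem tendsto_shiftEnergy_dilation_inv_pow (hΦ : IsRefinable m₀ Φ)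
    (h0 : Filter.Tendsto Φ (nhds 0) (nhds 1)) {φ : L2R}
    (hφ : (𝓕 φ : L2R) =ᵐ[volume] Φ) {g : L2R} (hg : 𝓕 g ∈ boundedSupport) :
    Filter.Tendsto (fun J : ℕ => shiftEnergy φ ((dilation⁻¹ ^ J) g)) Filter.atTop
      (nhds (‖g‖ₑ ^ 2)) := by
  obtain ⟨R, u, hu, hR⟩ := hg
  have hum := (Lp.memLp _).ae_eq hu
  have hlim : ‖g‖ₑ ^ 2 = ∫⁻ γ, ‖u γ‖ₑ ^ 2 := by
    rw [← ofReal_norm, ← Lp.norm_fourier_eq, ofReal_norm, ← lintegral_enorm_sq_coeFn]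
    refine lintegral_congr_ae ?_
    filter_upwards [hu] with x hx
    rw [hx]
  have hev : ∀ᶠ J : ℕ in Filter.atTop, 2 * R < 2 ^ J :=
    (tendsto_pow_atTop_atTop_of_one_lt one_lt_two).eventually_gt_atTop (2 * R)
  rw [hlim]
  refine Filter.Tendsto.congr' (f₁ := fun J : ℕ => ∫⁻ γ, ‖u γ‖ₑ ^ 2 * ‖Φ ((2 ^ J)⁻¹ * γ)‖ₑ ^ 2)
    (hev.mono fun J hJ => (hΦ.shiftEnergy_dilation_inv_pow hφ hu hR hJ).symm) ?_
  refine tendsto_lintegral_of_dominated_convergence' (fun γ => ‖u γ‖ₑ ^ 2) (fun J => ?_)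
    (fun J => Filter.Eventually.of_forall fun γ => ?_) (lintegral_enorm_sq_ne_top hum)
    (Filter.Eventually.of_forall fun γ => ?_)
  · refine (aemeasurable_enorm_sq hum).mul ?_
    exact aemeasurable_enorm_sq (memLp_comp_mul (by positivity) hΦ.memLp)
  · exact mul_le_of_le_one_right zero_le (hΦ.enorm_le_one _)
  · have h1 : Filter.Tendsto (fun J : ℕ => ((2 : ℝ) ^ J)⁻¹ * γ) Filter.atTop (nhds 0) := by
      have := (tendsto_inv_atTop_zero.comp
        (tendsto_pow_atTop_atTop_of_one_lt (one_lt_two (α := ℝ)))).mul_const γ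
      simpa using this
    have h2 := ENNReal.Tendsto.pow (n := 2) (h0.comp h1).enorm
    have h3 := ENNReal.Tendsto.const_mul (a := ‖u γ‖ₑ ^ 2) h2 (Or.inr (by simp))
    simpa using h3

end IsRefinable

/-! ### Decay of the energy of concentrating dilates. -/

theorem enorm_inner_sq_le {f : L2R} {u : ℝ → ℂ} (hu : f =ᵐ[volume] u) {ρ : ℝ}
    (hρ : ∀ x, ρ < |x| → u x = 0) (g : L2R) :
    ‖inner ℂ f g‖ₑ ^ 2 ≤ ‖f‖ₑ ^ 2 * ∫⁻ x in Set.Icc (-ρ) ρ, ‖g x‖ₑ ^ 2 := by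
  have h1 : inner ℂ f g = ∫ x in Set.Icc (-ρ) ρ, inner ℂ (f x) (g x) := by
    rw [L2.inner_def, ← setIntegral_eq_integral_of_ae_compl_eq_zero]
    filter_upwards [hu] with x hx hns
    rw [hx, hρ, inner_zero_left]
    by_contra! hle
    exact hns (abs_le.1 hle)
  have h2 : ‖inner ℂ f g‖ₑ ≤ ∫⁻ x in Set.Icc (-ρ) ρ, ‖f x‖ₑ * ‖g x‖ₑ := by
    rw [h1]
    refine (enorm_integral_le_lintegral_enorm _).trans (lintegral_mono fun x => ?_)
    rw [RCLike.inner_apply', enorm_mul, RCLike.enorm_conj]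
  have h3 := ENNReal.lintegral_mul_le_Lp_mul_Lq (volume.restrict (Set.Icc (-ρ) ρ))
    (Real.HolderConjugate.two_two) (f := fun x => ‖f x‖ₑ) (g := fun x => ‖g x‖ₑ)
    (Lp.memLp f).1.enorm.restrict (Lp.memLp g).1.enorm.restrict
  simp only [Pi.mul_apply, ENNReal.rpow_two] at h3
  refine (pow_le_pow_left' (h2.trans h3) 2).trans ?_
  rw [mul_pow, ← ENNReal.rpow_two, ← ENNReal.rpow_two, ← ENNReal.rpow_mul, ← ENNReal.rpow_mul]
  norm_num
  gcongr
  rw [← lintegral_enorm_sq_coeFn]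
  exact setLIntegral_le_lintegral _ _

theorem shiftEnergy_le_of_support {f : L2R} {u : ℝ → ℂ} (hu : f =ᵐ[volume] u) {ρ : ℝ}
    (hρ : ∀ x, ρ < |x| → u x = 0) (φ : L2R) :
    shiftEnergy φ f ≤ ‖f‖ₑ ^ 2 * ∫⁻ x in Set.Icc (-ρ) ρ, ∑' m : ℤ, ‖φ (x + m)‖ₑ ^ 2 := by
  have hm : ∀ m : ℤ, AEMeasurable (fun x : ℝ => ‖φ (x + m)‖ₑ ^ 2) volume := fun m =>
    (aestronglyMeasurable_comp_add_int (Lp.memLp φ).1 m).enorm.pow_const 2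
  rw [lintegral_tsum fun m => (hm m).restrict, ← ENNReal.tsum_mul_left,
    ← (Equiv.neg ℤ).tsum_eq fun m : ℤ => ‖f‖ₑ ^ 2 * ∫⁻ x in Set.Icc (-ρ) ρ, ‖φ (x + m)‖ₑ ^ 2]
  refine ENNReal.tsum_le_tsum fun k => (enorm_inner_sq_le hu hρ _).trans (le_of_eq ?_)
  congr 1
  refine lintegral_congr_ae (ae_restrict_of_ae ?_)
  filter_upwards [coeFn_translation (k : ℝ) φ] with x hx
  rw [hx]
  simp [sub_eq_add_neg]

/-- By Cauchy–Schwarz the energy is at most `‖f‖²` times the integral of the periodized `|φ|²` over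
the support. That periodization is integrable over a period and the supports shrink to measure 0. -/
theorem tendsto_shiftEnergy_dilation_pow (φ : L2R) {f : L2R} (hf : f ∈ boundedSupport) :
    Filter.Tendsto (fun J : ℕ => shiftEnergy φ ((dilation ^ J) f)) Filter.atTop (nhds 0) := by
  obtain ⟨R, u, hu, hR⟩ := hf
  have hsupp : ∀ J : ℕ, ∀ x : ℝ, R / 2 ^ J < |x| → (Real.sqrt 2 : ℂ) ^ J * u (2 ^ J * x) = 0 := by
    intro J x hx
    have h2J : (0 : ℝ) < 2 ^ J := by positivity
    rw [hR, mul_zero]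
    rw [abs_mul, abs_of_pos h2J]
    rwa [div_lt_iff₀' h2J] at hx
  have hRJ : Filter.Tendsto (fun J : ℕ => R / (2 : ℝ) ^ J) Filter.atTop (nhds 0) :=
    tendsto_const_nhds.div_atTop (tendsto_pow_atTop_atTop_of_one_lt (one_lt_two (α := ℝ)))
  -- A period centred at 0, so that it eventually contains the shrinking supports.
  set I : Set ℝ := Set.Ioc (-(1 / 2)) (-(1 / 2) + 1)
  have hfin : ∫⁻ x in I, ∑' m : ℤ, ‖φ (x + m)‖ₑ ^ 2 ≠ ⊤ := by
    rw [lintegral_periodize _ (aemeasurable_enorm_sq (Lp.memLp φ))]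
    exact lintegral_enorm_sq_ne_top (Lp.memLp φ)
  have hvol : Filter.Tendsto ((volume.restrict I) ∘
      fun J : ℕ => Set.Icc (-(R / (2 : ℝ) ^ J)) (R / (2 : ℝ) ^ J)) Filter.atTop (nhds 0) := by
    have h1 : Filter.Tendsto (fun J : ℕ => ENNReal.ofReal (2 * (R / (2 : ℝ) ^ J)))
        Filter.atTop (nhds 0) := by
      have := ENNReal.tendsto_ofReal (hRJ.const_mul 2)
      simpa using this
    refine tendsto_of_tendsto_of_tendsto_of_le_of_le tendsto_const_nhds h1 (fun _ => zero_le)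
      fun J => ?_
    refine (Measure.restrict_apply_le _ _).trans (le_of_eq ?_)
    rw [Real.volume_Icc]
    congr 1
    ring
  have h3 := ENNReal.Tendsto.const_mul (a := ‖f‖ₑ ^ 2) (tendsto_setLIntegral_zero hfin hvol)
    (Or.inr (by simp))
  rw [mul_zero] at h3
  refine tendsto_of_tendsto_of_tendsto_of_le_of_le' tendsto_const_nhds h3
    (Filter.Eventually.of_forall fun _ => zero_le) ?_
  filter_upwards [hRJ.eventually (gt_mem_nhds (by norm_num : (0 : ℝ) < 1 / 2))] with J hJ
  refine (shiftEnergy_le_of_support (coeFn_dilation_pow J hu) (hsupp J) φ).trans (le_of_eq ?_)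
  rw [← ofReal_norm, LinearIsometryEquiv.norm_map, ofReal_norm,
    Measure.restrict_restrict measurableSet_Icc, Set.inter_eq_left.2]
  intro x hx
  exact ⟨by linarith [hx.1], by linarith [hx.2]⟩

/-! ### The unitary extension principle -/

theorem exists_fourier_boundedSupport (f : L2R) (ε : ℝ) (hε : 0 < ε) :
    ∃ g ∈ {g : L2R | 𝓕 g ∈ boundedSupport}, ‖f - g‖ < ε := by
  obtain ⟨g, hg, hfg⟩ := exists_boundedSupport (Lp.fourierTransformₗᵢ ℝ ℂ f) ε hε
  obtain ⟨g', rfl⟩ := (Lp.fourierTransformₗᵢ ℝ ℂ).surjective g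
  refine ⟨g', hg, ?_⟩
  rwa [← map_sub (Lp.fourierTransformₗᵢ ℝ ℂ) f g', LinearIsometryEquiv.norm_map] at hfg

namespace IsRefinable

variable {m₀ Φ : ℝ → ℂ}

theorem tendsto_shiftNorm_dilation_inv_pow (hΦ : IsRefinable m₀ Φ)
    (h0 : Filter.Tendsto Φ (nhds 0) (nhds 1)) {φ : L2R} (hφ : (𝓕 φ : L2R) =ᵐ[volume] Φ) (f : L2R) :
    Filter.Tendsto (fun J : ℕ => shiftNorm φ ((dilation⁻¹ ^ J) f)) Filter.atTop (nhds ‖f‖) := by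
  refine tendsto_of_dense (p := fun J f => shiftNorm φ ((dilation⁻¹ ^ J) f))
    (q := fun f => ‖f‖) (S := {g | 𝓕 g ∈ boundedSupport}) (fun J f g => ?_)
    abs_norm_sub_norm_le exists_fourier_boundedSupport (fun g hg => ?_) f
  · refine (abs_shiftNorm_sub_le (shiftEnergy_le hΦ hφ) _ _).trans (le_of_eq ?_)
    rw [← map_sub, LinearIsometryEquiv.norm_map]
  · have h := hΦ.tendsto_shiftEnergy_dilation_inv_pow h0 hφ hg
    have h2 := (Real.continuous_sqrt.tendsto _).comp
      ((ENNReal.tendsto_toReal (by simp : ‖g‖ₑ ^ 2 ≠ ⊤)).comp h)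
    simpa [Function.comp_def, ← shiftNorm_eq_sqrt] using h2

theorem tendsto_shiftNorm_dilation_pow (hΦ : IsRefinable m₀ Φ)
    {φ : L2R} (hφ : (𝓕 φ : L2R) =ᵐ[volume] Φ) (f : L2R) :
    Filter.Tendsto (fun J : ℕ => shiftNorm φ ((dilation ^ J) f)) Filter.atTop (nhds 0) := by
  refine tendsto_of_dense (p := fun J f => shiftNorm φ ((dilation ^ J) f))
    (q := fun _ => 0) (S := boundedSupport) (fun J f g => ?_)
    (fun f g => by simp) exists_boundedSupport (fun g hg => ?_) f
  · refine (abs_shiftNorm_sub_le (shiftEnergy_le hΦ hφ) _ _).trans (le_of_eq ?_)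
    rw [← map_sub, LinearIsometryEquiv.norm_map]
  · have h := tendsto_shiftEnergy_dilation_pow φ hg
    have h2 := (Real.continuous_sqrt.tendsto _).comp
      ((ENNReal.tendsto_toReal ENNReal.zero_ne_top).comp h)
    simpa [Function.comp_def, ← shiftNorm_eq_sqrt] using h2

end IsRefinable

/-- Telescoping in both directions from `a 0`; monotonicity makes the terms nonnegative, so
convergence of partial sums gives summability. -/
theorem hasSum_int_sub_of_tendsto {a : ℤ → ℝ} (ha : ∀ j, a j ≤ a (j + 1)) {L : ℝ}
    (h1 : Filter.Tendsto (fun n : ℕ => a n) Filter.atTop (nhds L))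
    (h2 : Filter.Tendsto (fun n : ℕ => a (-n)) Filter.atTop (nhds 0)) :
    HasSum (fun j : ℤ => a (j + 1) - a j) L := by
  have e1 : HasSum (fun n : ℕ => a ((n : ℤ) + 1) - a n) (L - a 0) := by
    rw [hasSum_iff_tendsto_nat_of_nonneg fun n => sub_nonneg.2 (ha _)]
    have : ∀ n : ℕ, ∑ i ∈ Finset.range n, (a ((i : ℤ) + 1) - a i) = a n - a 0 := fun n => by
      simpa using Finset.sum_range_sub (fun i : ℕ => a i) n
    simp_rw [this]
    exact h1.sub_const _
  have e2 : HasSum (fun n : ℕ => a (-((n : ℤ) + 1) + 1) - a (-((n : ℤ) + 1))) (a 0) := by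
    rw [hasSum_iff_tendsto_nat_of_nonneg fun n => sub_nonneg.2 (ha _)]
    have : ∀ n : ℕ, ∑ i ∈ Finset.range n, (a (-((i : ℤ) + 1) + 1) - a (-((i : ℤ) + 1)))
        = a 0 - a (-n) := fun n => by
      have := Finset.sum_range_sub' (fun i : ℕ => a (-i)) n
      simp only [Nat.cast_add, Nat.cast_one, Nat.cast_zero, neg_zero] at this
      rw [← this]
      refine Finset.sum_congr rfl fun i _ => ?_
      congr 2
      ring
    simp_rw [this]
    simpa using h2.const_sub (a 0)
  have := HasSum.of_nat_of_neg_add_one (f := fun j : ℤ => a (j + 1) - a j) e1 e2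
  simpa using this

theorem inner_waveletSystem {N : ℕ} (ψ : Fin N → L2R) (f : L2R) (n : Fin N) (j k : ℤ) :
    inner ℂ f (waveletSystem ψ (n, j, k))
      = inner ℂ ((dilation ^ (-j)) f) (translation (k : ℝ) (ψ n)) := by
  rw [waveletSystem, ← LinearIsometryEquiv.inner_map_map (dilation ^ (-j)) f]
  congr 1
  change (dilation ^ (-j) * dilation ^ j) _ = _
  rw [← zpow_add, neg_add_cancel, zpow_zero]
  rfl

/-- The unitary extension principle. -/
theorem isParsevalFrame_waveletSystem {N : ℕ} {m₀ : ℝ → ℂ} {H : Fin N → ℝ → ℂ} {Φ : ℝ → ℂ}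
    (hF : IsExtensionFilter m₀ H) (hΦ : IsRefinable m₀ Φ)
    (h0 : Filter.Tendsto Φ (nhds 0) (nhds 1)) {φ : L2R} {ψ : Fin N → L2R}
    (hφ : (𝓕 φ : L2R) =ᵐ[volume] Φ) (hψ : IsGeneratedBy H φ ψ) :
    IsParsevalFrame (waveletSystem ψ) := by
  intro f
  have hfin : ∀ g, shiftEnergy φ g ≠ ⊤ := fun g =>
    ((shiftEnergy_le hΦ hφ g).trans_lt (by simp)).ne
  -- `a j` is the energy captured by `φ` at scale `j`, and `b j` the wavelet energy gained on
  -- passing to scale `j + 1`.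
  set a : ℤ → ℝ := fun j => (shiftEnergy φ ((dilation ^ (-j)) f)).toReal with ha
  set b : ℤ → ENNReal := fun j => ∑ n, shiftEnergy (ψ n) ((dilation ^ (-j)) f) with hb
  have hstep : ∀ j, shiftEnergy φ ((dilation ^ (-(j + 1))) f)
      = shiftEnergy φ ((dilation ^ (-j)) f) + b j := by
    intro j
    rw [hb, ← shiftEnergy_dilation_symm hF hΦ hφ hψ]
    congr 1
    have : (dilation ^ (-(j + 1)) : L2R ≃ₗᵢ[ℂ] L2R) = dilation⁻¹ * dilation ^ (-j) := by group
    rw [this]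
    rfl
  have hbfin : ∀ j, b j ≠ ⊤ := fun j =>
    (le_add_self.trans_lt ((hstep j).symm.trans_lt (hfin _).lt_top)).ne
  have hsub : ∀ j, (b j).toReal = a (j + 1) - a j := by
    intro j
    rw [ha]
    simp only
    rw [hstep j, ENNReal.toReal_add (hfin _) (hbfin j)]
    ring
  have hsum : HasSum (fun j => (b j).toReal) (‖f‖ ^ 2) := by
    simp_rw [hsub]
    refine hasSum_int_sub_of_tendsto (fun j => ?_) ?_ ?_
    · rw [← sub_nonneg, ← hsub]
      exact ENNReal.toReal_nonneg
    · have h := (hΦ.tendsto_shiftNorm_dilation_inv_pow h0 hφ f).pow 2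
      simp_rw [shiftNorm_sq] at h
      refine h.congr fun n => ?_
      simp only [ha]
      rw [zpow_neg, zpow_natCast, inv_pow]
    · have h := (hΦ.tendsto_shiftNorm_dilation_pow hφ f).pow 2
      simp_rw [shiftNorm_sq] at h
      rw [zero_pow two_ne_zero] at h
      refine h.congr fun n => ?_
      simp only [ha]
      rw [neg_neg, zpow_natCast]
  -- In `ENNReal` the sums over `n`, `j`, `k` may be rearranged freely; the finite total then gives
  -- real summability.
  have hE : ∑' i, ‖inner ℂ f (waveletSystem ψ i)‖ₑ ^ 2 = ENNReal.ofReal (‖f‖ ^ 2) := by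
    rw [ENNReal.tsum_prod', tsum_fintype]
    simp_rw [ENNReal.tsum_prod', inner_waveletSystem]
    change ∑ n, ∑' j : ℤ, shiftEnergy (ψ n) ((dilation ^ (-j)) f) = _
    rw [← Summable.tsum_finsetSum fun _ _ => ENNReal.summable]
    change ∑' j, b j = _
    rw [← hsum.tsum_eq, ENNReal.ofReal_tsum_of_nonneg (fun _ => ENNReal.toReal_nonneg)
      hsum.summable]
    exact tsum_congr fun j => (ENNReal.ofReal_toReal (hbfin j)).symm
  have h := ENNReal.hasSum_toReal (f := fun i => ‖inner ℂ f (waveletSystem ψ i)‖ₑ ^ 2)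
    (by rw [hE]; exact ENNReal.ofReal_ne_top)
  rw [← ENNReal.tsum_toReal_eq fun _ => by simp, hE, ENNReal.toReal_ofReal (by positivity)] at h
  simpa using h

/-! ### Infinite products of dilated filters -/

/-- The infinite product `∏_{n ≥ 1} m₀(2^{-n} γ)`. -/
def dyadicProd (m₀ : ℝ → ℂ) (γ : ℝ) : ℂ := ∏' n : ℕ, m₀ (γ / 2 ^ (n + 1))

section DyadicProd

variable {m₀ : ℝ → ℂ}

theorem exists_bound_near_zero (hO : (fun γ => m₀ γ - 1) =O[nhds 0] (fun γ : ℝ => γ)) :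
    ∃ C > 0, ∃ δ > 0, ∀ γ : ℝ, |γ| < δ → ‖m₀ γ - 1‖ ≤ C * |γ| := by
  obtain ⟨C, hC, h⟩ := hO.exists_pos
  obtain ⟨δ, hδ, h2⟩ := Metric.eventually_nhds_iff.1 h.bound
  exact ⟨C, hC, δ, hδ, fun γ hγ => h2 (by simpa using hγ)⟩

theorem summable_norm_dyadic (hO : (fun γ => m₀ γ - 1) =O[nhds 0] (fun γ : ℝ => γ)) (γ : ℝ) :
    Summable fun n : ℕ => ‖m₀ (γ / 2 ^ (n + 1)) - 1‖ := by
  have hg : Summable fun n : ℕ => γ / 2 ^ (n + 1) := by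
    have := (summable_geometric_two.mul_left (γ / 2))
    refine this.congr fun n => ?_
    rw [one_div, inv_pow, pow_succ]
    field_simp
  exact (summable_of_isBigO_nat' hg (hO.comp_tendsto hg.tendsto_atTop_zero)).norm

theorem multipliable_dyadic (hO : (fun γ => m₀ γ - 1) =O[nhds 0] (fun γ : ℝ => γ)) (γ : ℝ) :
    Multipliable fun n : ℕ => m₀ (γ / 2 ^ (n + 1)) := by
  simpa using multipliable_one_add_of_summable (summable_norm_dyadic hO γ)

theorem dyadicProd_refinement (hO : (fun γ => m₀ γ - 1) =O[nhds 0] (fun γ : ℝ => γ)) (γ : ℝ) :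
    dyadicProd m₀ γ = m₀ (γ / 2) * dyadicProd m₀ (γ / 2) := by
  have h : ∀ n : ℕ, m₀ (γ / 2 ^ (n + 1 + 1)) = m₀ (γ / 2 / 2 ^ (n + 1)) := fun n => by
    rw [div_div, pow_succ' _ (n + 1)]
  have h2 := multipliable_dyadic hO (γ / 2)
  rw [dyadicProd, tprod_eq_zero_mul' (by simp_rw [h]; exact h2)]
  simp_rw [h, zero_add, pow_one]
  rfl

/-- From `|∏(1 + a_n) - 1| ≤ exp(∑|a_n|) - 1` and `∑ C|γ| 2^{-n-1} = C|γ|`. -/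
theorem tendsto_dyadicProd_zero (hO : (fun γ => m₀ γ - 1) =O[nhds 0] (fun γ : ℝ => γ)) :
    Filter.Tendsto (dyadicProd m₀) (nhds 0) (nhds 1) := by
  obtain ⟨C, hC, δ, hδ, hb⟩ := exists_bound_near_zero hO
  have hbound : ∀ γ : ℝ, |γ| < δ → ‖dyadicProd m₀ γ - 1‖ ≤ Real.exp (C * |γ|) - 1 := by
    intro γ hγ
    have hprod := (multipliable_dyadic hO γ).hasProd.tendsto_prod_nat
    refine le_of_tendsto ((hprod.sub_const 1).norm) (Filter.Eventually.of_forall fun N => ?_)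
    have h1 := Finset.norm_prod_one_add_sub_one_le (Finset.range N)
      (fun n => m₀ (γ / 2 ^ (n + 1)) - 1)
    simp only [add_sub_cancel] at h1
    refine h1.trans (sub_le_sub_right (Real.exp_le_exp.2 ?_) 1)
    calc ∑ n ∈ Finset.range N, ‖m₀ (γ / 2 ^ (n + 1)) - 1‖
        ≤ ∑ n ∈ Finset.range N, C * |γ| * (1 / 2 / 2 ^ n) := by
          refine Finset.sum_le_sum fun n _ => ?_
          have h2 : |γ / 2 ^ (n + 1)| = |γ| * (1 / 2 / 2 ^ n) := by
            rw [abs_div, abs_of_pos (by positivity : (0 : ℝ) < 2 ^ (n + 1)), pow_succ]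
            field_simp
          rw [mul_assoc, ← h2]
          refine hb _ (lt_of_le_of_lt ?_ hγ)
          rw [h2]
          refine mul_le_of_le_one_right (abs_nonneg _) ?_
          rw [div_div, div_le_one (by positivity)]
          have := one_le_pow₀ (M₀ := ℝ) one_le_two (n := n)
          linarith
      _ ≤ C * |γ| := by
          rw [← Finset.mul_sum]
          refine mul_le_of_le_one_right (by positivity) ?_
          exact (Summable.sum_le_tsum _ (fun _ _ => by positivity)
            (summable_geometric_two' 1)).trans (tsum_geometric_two' 1).le
  have hlim : Filter.Tendsto (fun γ : ℝ => Real.exp (C * |γ|) - 1) (nhds 0) (nhds 0) := by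
    have : Continuous fun γ : ℝ => Real.exp (C * |γ|) - 1 := by fun_prop
    simpa using this.tendsto 0
  rw [tendsto_iff_norm_sub_tendsto_zero]
  refine tendsto_of_tendsto_of_tendsto_of_le_of_le' tendsto_const_nhds hlim
    (Filter.Eventually.of_forall fun _ => norm_nonneg _) ?_
  refine Metric.eventually_nhds_iff.2 ⟨δ, hδ, fun γ hγ => hbound γ (by simpa using hγ)⟩

theorem measurable_dyadicProd (hO : (fun γ => m₀ γ - 1) =O[nhds 0] (fun γ : ℝ => γ))
    (hm : Measurable m₀) : Measurable (dyadicProd m₀) := by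
  refine measurable_of_tendsto_metrizable (f := fun N γ => ∏ n ∈ Finset.range N,
    m₀ (γ / 2 ^ (n + 1))) (fun N => ?_) (tendsto_pi_nhds.2 fun γ =>
      (multipliable_dyadic hO γ).hasProd.tendsto_prod_nat)
  exact Finset.measurable_fun_prod _ fun n _ => hm.comp (measurable_id.div_const _)

theorem sum_range_two_mul {M : Type*} [AddCommMonoid M] (f : ℕ → M) (n : ℕ) :
    ∑ k ∈ Finset.range (2 * n), f k
      = ∑ k ∈ Finset.range n, f (2 * k) + ∑ k ∈ Finset.range n, f (2 * k + 1) := by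
  induction n with
  | zero => simp
  | succ n ih =>
    rw [show 2 * (n + 1) = 2 * n + 1 + 1 by ring, Finset.sum_range_succ, Finset.sum_range_succ, ih,
      Finset.sum_range_succ, Finset.sum_range_succ]
    abel

/-- The first factor depends only on the parity of `k`. Splitting by parity leaves two sums of the
same kind at the previous level, weighted by `|m₀|²` at two points half a period apart. -/
theorem sum_norm_sq_partialProd_le (hp : Function.Periodic m₀ 1)
    (h1 : ∀ γ, ‖m₀ γ‖ ^ 2 + ‖m₀ (γ + 1 / 2)‖ ^ 2 ≤ 1) (N : ℕ) (γ : ℝ) :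
    ∑ k ∈ Finset.range (2 ^ N), ‖∏ n ∈ Finset.range N, m₀ ((γ + k) / 2 ^ (n + 1))‖ ^ 2 ≤ 1 := by
  induction N generalizing γ with
  | zero => simp
  | succ N ih =>
    have hstep : ∀ x : ℝ, ‖∏ n ∈ Finset.range (N + 1), m₀ (x / 2 ^ (n + 1))‖ ^ 2
        = ‖m₀ (x / 2)‖ ^ 2 * ‖∏ n ∈ Finset.range N, m₀ (x / 2 / 2 ^ (n + 1))‖ ^ 2 := by
      intro x
      rw [Finset.prod_range_succ', norm_mul, mul_pow, mul_comm, zero_add, pow_one]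
      simp_rw [div_div, ← pow_succ']
    have he : ∀ k : ℕ, (γ + (2 * k : ℕ)) / 2 = γ / 2 + k := fun k => by push_cast; ring
    have ho : ∀ k : ℕ, (γ + (2 * k + 1 : ℕ)) / 2 = γ / 2 + 1 / 2 + k := fun k => by
      push_cast; ring
    have hper : ∀ (x : ℝ) (k : ℕ), m₀ (x + k) = m₀ x := fun x k => by
      simpa using hp.nat_mul k x
    rw [pow_succ', sum_range_two_mul]
    simp_rw [hstep, he, ho, hper, ← Finset.mul_sum]
    calc _ ≤ ‖m₀ (γ / 2)‖ ^ 2 * 1 + ‖m₀ (γ / 2 + 1 / 2)‖ ^ 2 * 1 := by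
          gcongr
          · exact ih _
          · exact ih _
      _ ≤ 1 := by simpa using h1 (γ / 2)

/-- A fixed window of `2M` integers lies in the window of length `2^N` once `N ≥ 2M`; let `N → ∞`
and then exhaust `ℤ`. -/
theorem tsum_enorm_sq_dyadicProd_le (hO : (fun γ => m₀ γ - 1) =O[nhds 0] (fun γ : ℝ => γ))
    (hp : Function.Periodic m₀ 1) (h1 : ∀ γ, ‖m₀ γ‖ ^ 2 + ‖m₀ (γ + 1 / 2)‖ ^ 2 ≤ 1) (γ : ℝ) :
    ∑' m : ℤ, ‖dyadicProd m₀ (γ + m)‖ₑ ^ 2 ≤ 1 := by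
  have hfin : ∀ M : ℕ, ∑ k ∈ Finset.range (2 * M), ‖dyadicProd m₀ (γ - M + k)‖ ^ 2 ≤ 1 := by
    intro M
    refine le_of_tendsto (tendsto_finsetSum _ fun k _ =>
      ((multipliable_dyadic hO (γ - M + k)).hasProd.tendsto_prod_nat.norm.pow 2)) ?_
    filter_upwards [Filter.eventually_ge_atTop (2 * M)] with N hN
    refine le_trans (Finset.sum_le_sum_of_subset_of_nonneg
      (Finset.range_mono (hN.trans Nat.lt_two_pow_self.le)) fun _ _ _ => by positivity)
      (sum_norm_sq_partialProd_le hp h1 N (γ - M))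
  rw [ENNReal.tsum_eq_iSup_sum]
  refine iSup_le fun s => ?_
  have e : ∀ x : ℂ, ‖x‖ₑ ^ 2 = ENNReal.ofReal (‖x‖ ^ 2) := fun x => by
    rw [ENNReal.ofReal_pow (norm_nonneg _), ofReal_norm]
  simp_rw [e]
  rw [← ENNReal.ofReal_sum_of_nonneg fun _ _ => by positivity]
  refine ENNReal.ofReal_le_one.2 ?_
  obtain ⟨M, hM⟩ : ∃ M : ℕ, ∀ m ∈ s, -(M : ℤ) ≤ m ∧ m < M := by
    refine ⟨∑ m ∈ s, (m.natAbs + 1), fun m hm => ?_⟩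
    have := Finset.single_le_sum (f := fun m : ℤ => m.natAbs + 1) (fun _ _ => by positivity) hm
    omega
  refine le_trans ?_ (hfin M)
  have hsub : s ⊆ (Finset.range (2 * M)).image fun k : ℕ => (k : ℤ) - M := by
    intro m hm
    have := hM m hm
    exact Finset.mem_image.2 ⟨(m + M).toNat, Finset.mem_range.2 (by omega), by omega⟩
  refine (Finset.sum_le_sum_of_subset_of_nonneg hsub fun _ _ _ => by positivity).trans ?_
  rw [Finset.sum_image fun a _ b _ h => by simpa using h]
  refine le_of_eq (Finset.sum_congr rfl fun k _ => ?_)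
  congr 3
  push_cast
  ring

theorem isRefinable_dyadicProd (hO : (fun γ => m₀ γ - 1) =O[nhds 0] (fun γ : ℝ => γ))
    (hm : Measurable m₀) (hp : Function.Periodic m₀ 1)
    (h1 : ∀ γ, ‖m₀ γ‖ ^ 2 + ‖m₀ (γ + 1 / 2)‖ ^ 2 ≤ 1) : IsRefinable m₀ (dyadicProd m₀) where
  memLp := by
    have hmeas := measurable_dyadicProd hO hm
    refine ⟨hmeas.aestronglyMeasurable, ?_⟩
    rw [eLpNorm_lt_top_iff_lintegral_rpow_enorm_lt_top two_ne_zero ENNReal.ofNat_ne_top]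
    simp only [ENNReal.toReal_ofNat, ENNReal.rpow_ofNat]
    rw [← lintegral_periodize_zero (hmeas.enorm.pow_const 2).aemeasurable]
    refine (lintegral_mono fun γ => tsum_enorm_sq_dyadicProd_le hO hp h1 γ).trans_lt ?_
    simp
  sum_sq_le := tsum_enorm_sq_dyadicProd_le hO hp h1
  refinement γ := by
    rw [dyadicProd_refinement hO γ, div_eq_inv_mul]

end DyadicProd

/-! ### The profile of the low-pass filter -/

/-- The rising factorial `z (z + 1) ⋯ (z + n - 1)`. -/
def rising (z : ℂ) (n : ℕ) : ℂ := ∏ i ∈ Finset.range n, (z + i)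

section Rising

variable {z : ℂ}

theorem rising_succ (z : ℂ) (n : ℕ) : rising z (n + 1) = rising z n * (z + n) :=
  Finset.prod_range_succ _ _

theorem add_natCast_ne_zero (hz : 0 < z.re) (n : ℕ) : z + n ≠ 0 := by
  intro h
  have := congrArg Complex.re h
  simp only [Complex.add_re, Complex.natCast_re, Complex.zero_re] at this
  have h2 : (0 : ℝ) ≤ n := n.cast_nonneg
  linarith

theorem rising_ne_zero (hz : 0 < z.re) (n : ℕ) : rising z n ≠ 0 :=
  Finset.prod_ne_zero_iff.2 fun i _ => add_natCast_ne_zero hz i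

theorem Gamma_add_natCast (hz : 0 < z.re) (n : ℕ) :
    Complex.Gamma (z + n) = rising z n * Complex.Gamma z := by
  induction n with
  | zero => simp [rising]
  | succ n ih =>
    rw [rising_succ, Nat.cast_succ, ← add_assoc, Complex.Gamma_add_one _ (add_natCast_ne_zero hz n),
      ih]
    ring

/-- The range includes `k = ℓ + 1`, the boundary coefficient in both the Pascal induction and the
telescoped derivative. -/
theorem cbinom_eq (hz : 0 < z.re) {ℓ k : ℕ} (hk : k ≤ ℓ + 1) :
    cbinom (z + ℓ) k = rising z (ℓ + 1) / (k.factorial * rising z (ℓ + 1 - k)) := by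
  have h1 : z + ℓ + 1 = z + (ℓ + 1 : ℕ) := by push_cast; ring
  have h2 : z + ℓ - k + 1 = z + (ℓ + 1 - k : ℕ) := by
    rw [Nat.cast_sub hk]; push_cast; ring
  rw [cbinom, h1, h2, Gamma_add_natCast hz, Gamma_add_natCast hz, Complex.Gamma_nat_eq_factorial,
    ← mul_assoc, mul_div_mul_right _ _ (Complex.Gamma_ne_zero_of_re_pos hz)]

theorem cbinom_zero (hz : 0 < z.re) (ℓ : ℕ) : cbinom (z + ℓ) 0 = 1 := by
  rw [cbinom_eq hz (Nat.zero_le _)]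
  simp [rising_ne_zero hz]

theorem cbinom_top (hz : 0 < z.re) (ℓ : ℕ) :
    cbinom (z + ℓ) (ℓ + 1) = rising z (ℓ + 1) / (ℓ + 1).factorial := by
  rw [cbinom_eq hz le_rfl]
  simp [rising]

theorem succ_mul_cbinom_succ (hz : 0 < z.re) {ℓ k : ℕ} (hk : k ≤ ℓ) :
    (k + 1) * cbinom (z + ℓ) (k + 1) = (z + ℓ - k) * cbinom (z + ℓ) k := by
  obtain ⟨d, rfl⟩ := Nat.exists_eq_add_of_le hk
  rw [cbinom_eq hz (by omega), cbinom_eq hz (by omega),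
    show k + d + 1 - (k + 1) = d by omega, show k + d + 1 - k = d + 1 by omega, rising_succ z d,
    Nat.factorial_succ]
  have h1 := rising_ne_zero hz d
  have h2 := add_natCast_ne_zero hz d
  have h3 : (k.factorial : ℂ) ≠ 0 := by exact_mod_cast k.factorial_ne_zero
  have h4 : (k + 1 : ℂ) ≠ 0 := by exact_mod_cast k.succ_ne_zero
  push_cast
  field_simp
  ring

theorem cbinom_pascal (hz : 0 < z.re) {ℓ k : ℕ} (hk : k ≤ ℓ) :
    cbinom (z + (ℓ + 1 : ℕ)) (k + 1) = cbinom (z + ℓ) (k + 1) + cbinom (z + ℓ) k := by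
  obtain ⟨d, rfl⟩ := Nat.exists_eq_add_of_le hk
  rw [cbinom_eq hz (by omega), cbinom_eq hz (by omega), cbinom_eq hz (by omega),
    show k + d + 1 + 1 - (k + 1) = d + 1 by omega, show k + d + 1 - (k + 1) = d by omega,
    show k + d + 1 - k = d + 1 by omega, rising_succ z d, rising_succ z (k + d + 1),
    Nat.factorial_succ]
  have h1 := rising_ne_zero hz d
  have h2 := add_natCast_ne_zero hz d
  have h3 : (k.factorial : ℂ) ≠ 0 := by exact_mod_cast k.factorial_ne_zero
  have h4 : (k + 1 : ℂ) ≠ 0 := by exact_mod_cast k.succ_ne_zero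
  push_cast
  field_simp
  ring

/-- The right side is the Taylor polynomial of `(1 - x)^(-z)`. By Pascal's rule, passing from `ℓ` to
`ℓ + 1` multiplies the left side by `x + y = 1` and adds the next Taylor term. -/
theorem sum_cbinom_eq (hz : 0 < z.re) (ℓ : ℕ) {x y : ℂ} (hxy : x + y = 1) :
    ∑ k ∈ Finset.range (ℓ + 1), cbinom (z + ℓ) k * x ^ k * y ^ (ℓ - k)
      = ∑ k ∈ Finset.range (ℓ + 1), rising z k / k.factorial * x ^ k := by
  induction ℓ with
  | zero =>
    have := cbinom_zero hz 0
    simpa [rising] using this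
  | succ ℓ ih =>
    rw [Finset.sum_range_succ (fun k => rising z k / k.factorial * x ^ k), ← ih]
    have e1 : ∑ k ∈ Finset.range (ℓ + 1 + 1),
        cbinom (z + (ℓ + 1 : ℕ)) k * x ^ k * y ^ (ℓ + 1 - k)
        = y ^ (ℓ + 1) + ∑ k ∈ Finset.range (ℓ + 1),
          (cbinom (z + ℓ) (k + 1) + cbinom (z + ℓ) k) * x ^ (k + 1) * y ^ (ℓ - k) := by
      rw [Finset.sum_range_succ', cbinom_zero hz, add_comm]
      congr 1
      · simp
      · refine Finset.sum_congr rfl fun k hk => ?_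
        rw [cbinom_pascal hz (Nat.lt_succ_iff.1 (Finset.mem_range.1 hk)), Nat.succ_sub_succ]
    have e2 : y ^ (ℓ + 1) + ∑ k ∈ Finset.range (ℓ + 1),
          cbinom (z + ℓ) (k + 1) * x ^ (k + 1) * y ^ (ℓ - k)
        = y * ∑ k ∈ Finset.range (ℓ + 1), cbinom (z + ℓ) k * x ^ k * y ^ (ℓ - k)
          + cbinom (z + ℓ) (ℓ + 1) * x ^ (ℓ + 1) := by
      have e3 : ∑ k ∈ Finset.range (ℓ + 1 + 1), cbinom (z + ℓ) k * x ^ k * y ^ (ℓ + 1 - k)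
          = y ^ (ℓ + 1) + ∑ k ∈ Finset.range (ℓ + 1),
          cbinom (z + ℓ) (k + 1) * x ^ (k + 1) * y ^ (ℓ - k) := by
        rw [Finset.sum_range_succ', cbinom_zero hz, add_comm]
        simp
      rw [← e3, Finset.sum_range_succ, Finset.mul_sum]
      congr 1
      · refine Finset.sum_congr rfl fun k hk => ?_
        rw [Nat.succ_sub (Nat.lt_succ_iff.1 (Finset.mem_range.1 hk)), pow_succ]
        ring
      · simp
    rw [e1]
    simp_rw [add_mul]
    rw [Finset.sum_add_distrib, ← add_assoc, e2, cbinom_top hz]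
    have e4 : ∑ k ∈ Finset.range (ℓ + 1), cbinom (z + ℓ) k * x ^ (k + 1) * y ^ (ℓ - k)
        = x * ∑ k ∈ Finset.range (ℓ + 1), cbinom (z + ℓ) k * x ^ k * y ^ (ℓ - k) := by
      rw [Finset.mul_sum]
      exact Finset.sum_congr rfl fun k _ => by ring
    rw [e4]
    linear_combination (∑ k ∈ Finset.range (ℓ + 1), cbinom (z + ℓ) k * x ^ k * y ^ (ℓ - k)) * hxy

end Rising

/-- The function `F` with `H₀(γ) = F(cos² πγ)`. -/
def profile (z : ℂ) (ℓ : ℕ) (y : ℝ) : ℂ :=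
  (y : ℂ) ^ z * ∑ k ∈ Finset.range (ℓ + 1), cbinom (z + ℓ) k * ((1 - y : ℝ) : ℂ) ^ k *
    (y : ℂ) ^ (ℓ - k)

theorem lowpass_eq_profile (z : ℂ) (ℓ : ℕ) (γ : ℝ) :
    lowpass z ℓ γ = profile z ℓ (Real.cos (Real.pi * γ) ^ 2) := by
  rw [lowpass, profile, ← Real.sin_sq]

theorem lowpass_add_half (z : ℂ) (ℓ : ℕ) (γ : ℝ) :
    lowpass z ℓ (γ + 1 / 2) = profile z ℓ (1 - Real.cos (Real.pi * γ) ^ 2) := by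
  rw [lowpass_eq_profile, mul_add, mul_one_div, Real.cos_add_pi_div_two, neg_sq, Real.sin_sq]

theorem lowpass_periodic (z : ℂ) (ℓ : ℕ) : Function.Periodic (lowpass z ℓ) 1 := by
  intro γ
  rw [lowpass_eq_profile, lowpass_eq_profile, mul_add, mul_one, Real.cos_add_pi, neg_sq]

section Profile

variable {z : ℂ} {ℓ : ℕ}

theorem continuous_profile (hz : 0 < z.re) : Continuous (profile z ℓ) := by
  refine (Complex.continuous_ofReal_cpow_const hz).mul ?_
  fun_prop

theorem continuous_lowpass (hz : 0 < z.re) : Continuous (lowpass z ℓ) := by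
  rw [funext (lowpass_eq_profile z ℓ)]
  exact (continuous_profile hz).comp (by fun_prop)

theorem profile_zero (hz : 0 < z.re) : profile z ℓ 0 = 0 := by
  have : z ≠ 0 := by rintro rfl; simp at hz
  simp [profile, this]

theorem profile_one (hz : 0 < z.re) : profile z ℓ 1 = 1 := by
  rw [profile, Finset.sum_eq_single 0]
  · simp [cbinom_zero hz]
  · intro k _ hk
    simp [hk]
  · simp

theorem profile_eq_rising (hz : 0 < z.re) (y : ℝ) :
    profile z ℓ y = (y : ℂ) ^ z *
      ∑ k ∈ Finset.range (ℓ + 1), rising z k / k.factorial * ((1 - y : ℝ) : ℂ) ^ k := by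
  rw [profile, sum_cbinom_eq hz]
  push_cast; ring

theorem hasDerivAt_profile (hz : 1 ≤ z.re) {y : ℝ} (hy : 0 < y) :
    HasDerivAt (profile z ℓ) (rising z (ℓ + 1) / ℓ.factorial * (y : ℂ) ^ (z - 1) *
      ((1 - y : ℝ) : ℂ) ^ ℓ) y := by
  have hz0 : 0 < z.re := by linarith
  set T : ℕ → ℝ → ℂ := fun k y => cbinom (z + ℓ) k * (((1 - y : ℝ) : ℂ) ^ k *
    (y : ℂ) ^ (z + (ℓ - k : ℕ))) with hT
  -- The `k`-th summand has derivative `A (k + 1) - A k` by `succ_mul_cbinom_succ`, so only `A (ℓ +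
  -- 1)` survives. The truncated exponent `k - 1` is harmless: the factor `k` kills `A 0`.
  set A : ℕ → ℂ := fun k => k * cbinom (z + ℓ) k * ((1 - y : ℝ) : ℂ) ^ (k - 1) *
    (y : ℂ) ^ (z + ℓ - k) with hA
  have hd : ∀ k ∈ Finset.range (ℓ + 1), HasDerivAt (T k) (A (k + 1) - A k) y := by
    intro k hk
    have hk' : k ≤ ℓ := Nat.lt_succ_iff.1 (Finset.mem_range.1 hk)
    have h1 : HasDerivAt (fun y : ℝ => ((1 - y : ℝ) : ℂ) ^ k)
        (k * ((1 - y : ℝ) : ℂ) ^ (k - 1) * (-1 : ℂ)) y := by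
      have h0 : HasDerivAt (fun y : ℝ => ((1 - y : ℝ) : ℂ)) ((-1 : ℝ) : ℂ) y :=
        ((hasDerivAt_id y).const_sub 1).ofReal_comp
      exact (h0.fun_pow k).congr_deriv (by simp)
    have hne : z + (ℓ - k : ℕ) ≠ 0 := add_natCast_ne_zero hz0 _
    have h2 := hasDerivAt_ofReal_cpow_const hy.ne' hne
    have h3 := (h1.mul h2).const_mul (cbinom (z + ℓ) k)
    refine h3.congr_deriv ?_
    have e1 : z + (ℓ - k : ℕ) = z + ℓ - k := by rw [Nat.cast_sub hk']; ring
    have e2 : z + ℓ - (k + 1 : ℕ) = z + ℓ - k - 1 := by push_cast; ring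
    simp only [hA]
    rw [e1, e2, Nat.add_sub_cancel, Nat.cast_succ, succ_mul_cbinom_succ hz0 hk']
    ring
  have hsum := HasDerivAt.fun_sum hd
  rw [Finset.sum_range_sub] at hsum
  have hA0 : A 0 = 0 := by simp [hA]
  have hAl : A (ℓ + 1) = rising z (ℓ + 1) / ℓ.factorial * (y : ℂ) ^ (z - 1) *
      ((1 - y : ℝ) : ℂ) ^ ℓ := by
    have e2 : z + ℓ - (ℓ + 1 : ℕ) = z - 1 := by push_cast; ring
    have h3 : (ℓ.factorial : ℂ) ≠ 0 := by exact_mod_cast ℓ.factorial_ne_zero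
    have h4 : (ℓ + 1 : ℂ) ≠ 0 := by exact_mod_cast ℓ.succ_ne_zero
    simp only [hA]
    rw [e2, cbinom_top hz0, Nat.add_sub_cancel, Nat.factorial_succ]
    push_cast
    field_simp
  rw [hA0, sub_zero, hAl] at hsum
  refine hsum.congr_of_eventuallyEq ?_
  filter_upwards [lt_mem_nhds hy] with x hx
  have hx0 : (x : ℂ) ≠ 0 := by exact_mod_cast hx.ne'
  rw [profile, Finset.mul_sum]
  refine Finset.sum_congr rfl fun k hk => ?_
  simp only [hT]
  rw [Complex.cpow_add _ _ hx0, Complex.cpow_natCast]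
  ring

theorem isBigO_lowpass_sub_one (hz : 1 ≤ z.re) :
    (fun γ => lowpass z ℓ γ - 1) =O[nhds 0] (fun γ : ℝ => γ) := by
  have hz0 : 0 < z.re := by linarith
  have hc : DifferentiableAt ℝ (fun γ : ℝ => Real.cos (Real.pi * γ) ^ 2) 0 := by fun_prop
  have hp : DifferentiableAt ℝ (profile z ℓ) (Real.cos (Real.pi * 0) ^ 2) :=
    (hasDerivAt_profile hz (by simp)).differentiableAt
  have h := (hp.comp (0 : ℝ) hc).isBigO_sub
  simpa [Function.comp_def, ← lowpass_eq_profile, profile_one hz0] using h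

end Profile

/-! ### Nonnegativity of `η` -/

/-- In the right half-plane the argument is an arctangent, so arguments of products are sums of
arctangents without reduction modulo `2π`. -/
theorem eq_norm_mul_exp_arctan {w : ℂ} (hw : 0 < w.re) :
    w = ‖w‖ * Complex.exp ((Real.arctan (w.im / w.re) : ℝ) * Complex.I) := by
  set t := w.im / w.re with ht
  have hs : 0 < Real.sqrt (1 + t ^ 2) := Real.sqrt_pos.2 (by positivity)
  have hn : ‖w‖ = w.re * Real.sqrt (1 + t ^ 2) := by
    rw [Complex.norm_eq_sqrt_sq_add_sq, ← Real.sqrt_sq hw.le, ← Real.sqrt_mul (sq_nonneg _),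
      Real.sqrt_sq hw.le]
    congr 1
    rw [ht]
    field_simp
  rw [Complex.exp_mul_I, ← Complex.ofReal_cos, ← Complex.ofReal_sin, Real.cos_arctan,
    Real.sin_arctan, hn]
  apply Complex.ext
  · simp
    field_simp
  · simp
    rw [ht]
    field_simp

theorem prod_eq_norm_mul_exp_arctan {ι : Type*} (s : Finset ι) {w : ι → ℂ}
    (hw : ∀ i ∈ s, 0 < (w i).re) :
    ∏ i ∈ s, w i = ((∏ i ∈ s, ‖w i‖ : ℝ) : ℂ) *
      Complex.exp ((∑ i ∈ s, Real.arctan ((w i).im / (w i).re) : ℝ) * Complex.I) := by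
  rw [Finset.prod_congr rfl fun i hi => eq_norm_mul_exp_arctan (hw i hi), Finset.prod_mul_distrib,
    ← Complex.exp_sum, ← Finset.sum_mul, Complex.ofReal_prod, Complex.ofReal_sum]

theorem re_prod_nonneg {ι : Type*} (s : Finset ι) {w : ι → ℂ} (hw : ∀ i ∈ s, 0 < (w i).re)
    (h : |∑ i ∈ s, Real.arctan ((w i).im / (w i).re)| ≤ Real.pi / 2) :
    0 ≤ (∏ i ∈ s, w i).re := by
  rw [prod_eq_norm_mul_exp_arctan s hw, Complex.re_ofReal_mul, Complex.exp_ofReal_mul_I_re]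
  exact mul_nonneg (Finset.prod_nonneg fun _ _ => norm_nonneg _)
    (Real.cos_nonneg_of_mem_Icc (abs_le.1 h))

section

variable {z : ℂ} {ℓ : ℕ}

/-- All summands share the sign of `Im z`, so nothing cancels. -/
theorem abs_sum_arctan_le (hz : 0 < z.re) {s t : Finset ℕ} (hst : s ⊆ t) :
    |∑ i ∈ s, Real.arctan (z.im / (z.re + i))| ≤ |∑ i ∈ t, Real.arctan (z.im / (z.re + i))| := by
  have hpos : ∀ i : ℕ, 0 < z.re + i := fun i => by positivity
  rcases le_total 0 z.im with him | him
  · have h0 : ∀ i : ℕ, 0 ≤ Real.arctan (z.im / (z.re + i)) := fun i =>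
      Real.arctan_nonneg.2 (div_nonneg him (hpos i).le)
    rw [abs_of_nonneg (Finset.sum_nonneg fun i _ => h0 i),
      abs_of_nonneg (Finset.sum_nonneg fun i _ => h0 i)]
    exact Finset.sum_le_sum_of_subset_of_nonneg hst fun i _ _ => h0 i
  · have h0 : ∀ i : ℕ, Real.arctan (z.im / (z.re + i)) ≤ 0 := fun i =>
      Real.arctan_le_zero.2 (div_nonpos_of_nonpos_of_nonneg him (hpos i).le)
    rw [abs_of_nonpos (Finset.sum_nonpos fun i _ => h0 i),
      abs_of_nonpos (Finset.sum_nonpos fun i _ => h0 i), neg_le_neg_iff]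
    exact Finset.sum_le_sum_of_subset_of_nonpos' hst fun i _ _ => h0 i

/-- The conjugate factor cancels the argument of `rising z k`, leaving the product of `z + i` for `k
≤ i ≤ ℓ`; its argument is part of the given sum, hence at most `π/2` in size. -/
theorem re_conj_rising_mul_nonneg (hz : 0 < z.re)
    (harg : |∑ j ∈ Finset.range (ℓ + 1), Real.arctan (z.im / (z.re + j))| ≤ Real.pi / 2) {k : ℕ}
    (hk : k ≤ ℓ) :
    0 ≤ ((starRingEnd ℂ) (rising z k / k.factorial) * (rising z (ℓ + 1) / ℓ.factorial)).re := by
  have h1 : rising z (ℓ + 1) = rising z k * ∏ i ∈ Finset.Ico k (ℓ + 1), (z + i) :=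
    (Finset.prod_range_mul_prod_Ico _ (by omega)).symm
  have h2 : 0 ≤ (∏ i ∈ Finset.Ico k (ℓ + 1), (z + (i : ℂ))).re := by
    refine re_prod_nonneg _ (fun i _ => by simp; positivity) ?_
    simp only [Complex.add_re, Complex.add_im, Complex.natCast_re, Complex.natCast_im, add_zero]
    refine (abs_sum_arctan_le hz ?_).trans harg
    intro i hi
    exact Finset.mem_range.2 (Finset.mem_Ico.1 hi).2
  have h3 : (starRingEnd ℂ) (rising z k / k.factorial) * (rising z (ℓ + 1) / ℓ.factorial)
      = ((‖rising z k‖ ^ 2 / (k.factorial * ℓ.factorial) : ℝ) : ℂ) *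
        ∏ i ∈ Finset.Ico k (ℓ + 1), (z + i) := by
    have h4 := Complex.conj_mul' (rising z k)
    rw [h1, map_div₀, Complex.conj_natCast]
    push_cast
    rw [← h4]
    ring
  rw [h3, Complex.re_ofReal_mul]
  positivity

/-- The derivative of `|F|²` for the profile `F` of the low-pass filter. -/
def profileSqDeriv (z : ℂ) (ℓ : ℕ) (y : ℝ) : ℝ :=
  ∑ k ∈ Finset.range (ℓ + 1), 2 * ((starRingEnd ℂ) (rising z k / k.factorial) *
    (rising z (ℓ + 1) / ℓ.factorial)).re * (y ^ (2 * z.re - 1) * (1 - y) ^ (ℓ + k))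

theorem hasDerivAt_norm_sq_profile (hz : 1 ≤ z.re) {y : ℝ} (hy : 0 < y) :
    HasDerivAt (fun y => ‖profile z ℓ y‖ ^ 2) (profileSqDeriv z ℓ y) y := by
  have hz0 : 0 < z.re := by linarith
  refine (hasDerivAt_profile hz hy).norm_sq.congr_deriv ?_
  have hy0 : (y : ℂ) ≠ 0 := by exact_mod_cast hy.ne'
  have hpow : (starRingEnd ℂ) ((y : ℂ) ^ z) * (y : ℂ) ^ (z - 1)
      = ((y ^ (2 * z.re - 1) : ℝ) : ℂ) := by
    have h1 : (y : ℂ) ^ z = y * (y : ℂ) ^ (z - 1) := by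
      rw [Complex.cpow_sub _ _ hy0, Complex.cpow_one, mul_div_cancel₀ _ hy0]
    rw [h1, map_mul, Complex.conj_ofReal, mul_assoc, Complex.conj_mul',
      Complex.norm_cpow_eq_rpow_re_of_pos hy]
    norm_cast
    rw [← Real.rpow_natCast, ← Real.rpow_mul hy.le, ← Real.rpow_one_add' hy.le]
    · congr 1
      simp
      ring
    · simp
      linarith
  rw [Complex.inner, profile_eq_rising hz0, profileSqDeriv, map_mul, map_sum]
  have h2 : (starRingEnd ℂ) ((y : ℂ) ^ z) * (∑ k ∈ Finset.range (ℓ + 1),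
      (starRingEnd ℂ) (rising z k / k.factorial * ((1 - y : ℝ) : ℂ) ^ k)) *
      (rising z (ℓ + 1) / ℓ.factorial * (y : ℂ) ^ (z - 1) * ((1 - y : ℝ) : ℂ) ^ ℓ)
      = ∑ k ∈ Finset.range (ℓ + 1), ((y ^ (2 * z.re - 1) * (1 - y) ^ (ℓ + k) : ℝ) : ℂ) *
        ((starRingEnd ℂ) (rising z k / k.factorial) * (rising z (ℓ + 1) / ℓ.factorial)) := by
    rw [mul_comm ((starRingEnd ℂ) ((y : ℂ) ^ z)), Finset.sum_mul, Finset.sum_mul]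
    refine Finset.sum_congr rfl fun k _ => ?_
    rw [Complex.ofReal_mul, ← hpow, map_mul, map_pow, Complex.conj_ofReal, pow_add]
    push_cast
    ring
  rw [mul_comm (_ * _ * _) (_ * _), h2, Complex.re_sum, Finset.mul_sum]
  refine Finset.sum_congr rfl fun k _ => ?_
  rw [Complex.re_ofReal_mul]
  ring

theorem profileSqDeriv_le (hz : 1 ≤ z.re) (hℓ : (ℓ : ℝ) ≤ z.re - 1 / 2)
    (harg : |∑ j ∈ Finset.range (ℓ + 1), Real.arctan (z.im / (z.re + j))| ≤ Real.pi / 2) {y : ℝ}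
    (hy : 0 < y) (hy2 : y ≤ 1 / 2) : profileSqDeriv z ℓ y ≤ profileSqDeriv z ℓ (1 - y) := by
  have hy3 : 0 < 1 - y := by linarith
  refine Finset.sum_le_sum fun k hk => mul_le_mul_of_nonneg_left ?_
    (mul_nonneg zero_le_two (re_conj_rising_mul_nonneg (by linarith) harg
      (Nat.lt_succ_iff.1 (Finset.mem_range.1 hk))))
  obtain ⟨d, rfl⟩ := Nat.exists_eq_add_of_le (Nat.lt_succ_iff.1 (Finset.mem_range.1 hk))
  -- With `ℓ = k + d`, the exponent is `2ℓ` plus a remainder that is nonnegative exactly because `ℓ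
  -- ≤ Re z - 1/2`. After the common factor `(y(1 - y))^(ℓ + k)` is removed, two monotone powers are
  -- compared.
  have hsplit : ∀ x : ℝ, 0 < x → x ^ (2 * z.re - 1)
      = x ^ (2 * z.re - 1 - (2 * (k + d) : ℕ)) * x ^ (2 * (k + d)) := by
    intro x hx
    rw [← Real.rpow_natCast x (2 * (k + d)), ← Real.rpow_add hx]
    congr 1
    ring
  rw [hsplit y hy, hsplit (1 - y) hy3, sub_sub_cancel]
  push_cast at hℓ ⊢
  have h1 : y ^ (2 * z.re - 1 - 2 * (k + d : ℝ)) ≤ (1 - y) ^ (2 * z.re - 1 - 2 * (k + d : ℝ)) :=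
    Real.rpow_le_rpow hy.le (by linarith) (by linarith)
  have h2 : y ^ d ≤ (1 - y) ^ d := pow_le_pow_left₀ hy.le (by linarith) d
  have h3 : y ^ (2 * (k + d)) * (1 - y) ^ (k + d + k) = (y * (1 - y)) ^ (k + d + k) * y ^ d := by
    rw [mul_pow, show 2 * (k + d) = (k + d + k) + d by ring, pow_add]
    ring
  have h4 : (1 - y) ^ (2 * (k + d)) * y ^ (k + d + k)
      = (y * (1 - y)) ^ (k + d + k) * (1 - y) ^ d := by
    rw [mul_pow, show 2 * (k + d) = (k + d + k) + d by ring, pow_add]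
    ring
  rw [mul_assoc, mul_assoc, h3, h4]
  gcongr

theorem norm_sq_profile_add_le_one (hz : 1 ≤ z.re) (hℓ : (ℓ : ℝ) ≤ z.re - 1 / 2)
    (harg : |∑ j ∈ Finset.range (ℓ + 1), Real.arctan (z.im / (z.re + j))| ≤ Real.pi / 2) {y : ℝ}
    (hy : 0 ≤ y) (hy1 : y ≤ 1) : ‖profile z ℓ y‖ ^ 2 + ‖profile z ℓ (1 - y)‖ ^ 2 ≤ 1 := by
  have hz0 : 0 < z.re := by linarith
  set G : ℝ → ℝ := fun y => ‖profile z ℓ y‖ ^ 2 + ‖profile z ℓ (1 - y)‖ ^ 2 with hG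
  have hc : Continuous G := by
    have := continuous_profile (ℓ := ℓ) hz0
    fun_prop
  have hd : ∀ y ∈ Set.Ioo (0 : ℝ) (1 / 2),
      HasDerivAt G (profileSqDeriv z ℓ y - profileSqDeriv z ℓ (1 - y)) y := by
    intro y hy
    have h1 := hasDerivAt_norm_sq_profile (ℓ := ℓ) hz hy.1
    have h2 := hasDerivAt_norm_sq_profile (ℓ := ℓ) hz (by linarith [hy.2] : 0 < 1 - y)
    have h3 := h2.comp y ((hasDerivAt_id y).const_sub 1)
    exact (h1.add h3).congr_deriv (by ring)
  have hanti : AntitoneOn G (Set.Icc 0 (1 / 2)) := by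
    refine antitoneOn_of_deriv_nonpos (convex_Icc _ _) hc.continuousOn ?_ ?_
    · rw [interior_Icc]
      exact fun y hy => (hd y hy).differentiableAt.differentiableWithinAt
    · rw [interior_Icc]
      intro y hy
      rw [(hd y hy).deriv, sub_nonpos]
      exact profileSqDeriv_le hz hℓ harg hy.1 hy.2.le
  have hG0 : G 0 = 1 := by simp [hG, profile_zero hz0, profile_one hz0]
  have hhalf : ∀ x ∈ Set.Icc (0 : ℝ) (1 / 2), G x ≤ 1 := fun x hx => by
    rw [← hG0]
    exact hanti ⟨le_rfl, by norm_num⟩ hx hx.1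
  rcases le_total y (1 / 2) with h | h
  · exact hhalf y ⟨hy, h⟩
  · have := hhalf (1 - y) ⟨by linarith, by linarith⟩
    simp only [hG, sub_sub_cancel] at this
    linarith

theorem eta_nonneg (hz : 1 ≤ z.re) (hℓ : (ℓ : ℝ) ≤ z.re - 1 / 2)
    (harg : |∑ j ∈ Finset.range (ℓ + 1), Real.arctan (z.im / (z.re + j))| ≤ Real.pi / 2) (γ : ℝ) :
    0 ≤ eta z ℓ γ := by
  rw [eta, lowpass_add_half, lowpass_eq_profile, sub_nonneg]
  exact norm_sq_profile_add_le_one hz hℓ harg (sq_nonneg _) (Real.cos_sq_le_one _)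

theorem eta_periodic (z : ℂ) (ℓ : ℕ) : Function.Periodic (eta z ℓ) 1 := by
  intro γ
  rw [eta, eta, lowpass_periodic z ℓ γ, add_right_comm γ 1, lowpass_periodic z ℓ (γ + 1 / 2)]

theorem exists_measurable_periodic_root (hz : 1 ≤ z.re) (hη : ∀ γ, 0 ≤ eta z ℓ γ) :
    ∃ σ : ℝ → ℂ, Measurable σ ∧ Function.Periodic σ 1 ∧ ∀ γ, ‖σ γ‖ ^ 2 = eta z ℓ γ := by
  refine ⟨fun γ => (Real.sqrt (eta z ℓ γ) : ℂ), ?_, fun γ => ?_, fun γ => ?_⟩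
  · have hc := continuous_lowpass (ℓ := ℓ) (by linarith : 0 < z.re)
    have : Continuous (eta z ℓ) := by
      unfold eta
      fun_prop
    exact (Complex.continuous_ofReal.comp this.sqrt).measurable
  · simp only [eta_periodic z ℓ γ]
  · rw [Complex.norm_real, Real.norm_of_nonneg (Real.sqrt_nonneg _), Real.sq_sqrt (hη γ)]

end

/-! ### The wavelet filters -/

section

variable {z : ℂ} {ℓ : ℕ} {σ : ℝ → ℂ}

theorem norm_exp_two_pi_I_mul (γ : ℝ) : ‖Complex.exp (2 * Real.pi * Complex.I * γ)‖ = 1 := by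
  simpa using norm_character (-1) γ

theorem exp_two_pi_I_mul_add_half (γ : ℝ) :
    Complex.exp (2 * Real.pi * Complex.I * ((γ + 1 / 2 : ℝ) : ℂ))
      = -Complex.exp (2 * Real.pi * Complex.I * γ) := by
  have : (2 * Real.pi * Complex.I * ((γ + 1 / 2 : ℝ) : ℂ) : ℂ)
      = 2 * Real.pi * Complex.I * γ + Real.pi * Complex.I := by
    push_cast; ring
  rw [this, Complex.exp_add, Complex.exp_pi_mul_I]
  ring

theorem exp_two_pi_I_mul_periodic :
    Function.Periodic (fun γ : ℝ => Complex.exp (2 * Real.pi * Complex.I * γ)) 1 := by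
  intro γ
  have : (2 * Real.pi * Complex.I * ((γ + 1 : ℝ) : ℂ) : ℂ)
      = 2 * Real.pi * Complex.I * γ + 2 * Real.pi * Complex.I := by
    push_cast; ring
  simp only [this]
  exact Complex.exp_periodic _

theorem isExtensionFilter_highpass (hz : 0 < z.re) (hσm : AEMeasurable σ volume)
    (hσp : Function.Periodic σ 1) (hσ : ∀ γ, ‖σ γ‖ ^ 2 = eta z ℓ γ) :
    IsExtensionFilter (lowpass z ℓ) (highpass z ℓ σ) where
  periodic_lowpass := lowpass_periodic z ℓ
  periodic n γ := by
    have hexp := exp_two_pi_I_mul_periodic γ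
    simp only at hexp
    have hl := lowpass_periodic z ℓ (γ + 1 / 2)
    rw [add_right_comm] at hl
    fin_cases n <;> simp [highpass, hσp γ, -Complex.ofReal_add, hexp]
    simp at hl
    rw [hl]
  aestronglyMeasurable n := by
    have hc := continuous_lowpass (ℓ := ℓ) hz
    have h0 : Continuous fun γ : ℝ => Complex.exp (2 * Real.pi * Complex.I * γ) *
        (starRingEnd ℂ) (lowpass z ℓ (γ + 1 / 2)) := by
      have := Complex.continuous_conj
      fun_prop
    have h1 : AEMeasurable (fun γ : ℝ => 1 / (Real.sqrt 2 : ℂ) * σ γ) volume := by fun_prop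
    have h2 : AEMeasurable (fun γ : ℝ => 1 / (Real.sqrt 2 : ℂ) *
        Complex.exp (2 * Real.pi * Complex.I * γ) * σ γ) volume := by fun_prop
    fin_cases n
    · exact h0.aestronglyMeasurable
    · exact h1.aestronglyMeasurable
    · exact h2.aestronglyMeasurable
  sum_sq γ := by
    have h := hσ γ
    rw [eta] at h
    rw [Fin.sum_univ_three]
    simp [highpass, norm_exp_two_pi_I_mul, mul_pow, h]
    ring
  sum_cross γ := by
    have hl := lowpass_periodic z ℓ γ
    have hl2 : γ + 1 / 2 + 1 / 2 = γ + 1 := by ring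
    have he : Complex.exp (2 * Real.pi * Complex.I * γ) *
        (starRingEnd ℂ) (Complex.exp (2 * Real.pi * Complex.I * γ)) = 1 := by
      rw [Complex.mul_conj', norm_exp_two_pi_I_mul]
      simp
    rw [Fin.sum_univ_three]
    simp only [highpass, Matrix.cons_val_zero, Matrix.cons_val_one, Matrix.cons_val,
      exp_two_pi_I_mul_add_half, hl2, hl, map_mul, map_neg, Complex.conj_conj, map_div₀, map_one,
      Complex.conj_ofReal]
    -- The half shift flips the sign of the exponential: the first filter cancels the low-pass term
    -- and the third cancels the second, with no condition relating `σ(γ)` and `σ(γ + 1/2)`.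
    linear_combination (-(starRingEnd ℂ) (lowpass z ℓ (γ + 1 / 2)) * lowpass z ℓ γ
      - (1 / (Real.sqrt 2 : ℂ)) ^ 2 * σ γ * (starRingEnd ℂ) (σ (γ + 1 / 2))) * he

end

/-! ### Functions with a prescribed Fourier transform -/

theorem existsUnique_fourier_eq {u : ℝ → ℂ} (hu : MemLp u 2 volume) :
    ∃! φ : L2R, ((𝓕 φ : L2R) : ℝ → ℂ) =ᵐ[volume] u := by
  obtain ⟨φ, hφ⟩ := (Lp.fourierTransformₗᵢ ℝ ℂ).surjective (hu.toLp u)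
  have hφ' : 𝓕 φ = hu.toLp u := hφ
  refine ⟨φ, by simp only [hφ']; exact hu.coeFn_toLp, fun φ' h' => ?_⟩
  apply (Lp.fourierTransformₗᵢ ℝ ℂ).injective
  rw [hφ]
  exact Lp.ext (h'.trans hu.coeFn_toLp.symm)

theorem generated_iff_ae_eq_filtered {h Φ : ℝ → ℂ} {φ ψ : L2R} (hφ : (𝓕 φ : L2R) =ᵐ[volume] Φ) :
    (∀ᵐ γ : ℝ, (𝓕 ψ : L2R) (2 * γ) = h γ * (𝓕 φ : L2R) γ) ↔
      (𝓕 ψ : L2R) =ᵐ[volume] filtered h Φ := by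
  refine ⟨ae_eq_filtered_of_generated hφ, fun hψ => ?_⟩
  filter_upwards [ae_mul_left two_pos hψ, hφ] with γ h1 h2
  rw [h1, h2, filtered, inv_mul_cancel_left₀ two_ne_zero]

theorem existsUnique_generated {N : ℕ} {m₀ Φ : ℝ → ℂ} {H : Fin N → ℝ → ℂ}
    (hF : IsExtensionFilter m₀ H) (hΦ : IsRefinable m₀ Φ) {φ : L2R}
    (hφ : (𝓕 φ : L2R) =ᵐ[volume] Φ) : ∃! ψ : Fin N → L2R, IsGeneratedBy H φ ψ := by
  have h := fun n => existsUnique_fourier_eq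
    (memLp_filtered (hF.aestronglyMeasurable n) (hF.norm_le_one n) hΦ.memLp)
  choose ψ hψ huniq using h
  exact ⟨ψ, fun n => (generated_iff_ae_eq_filtered hφ).2 (hψ n), fun ψ' h' =>
    funext fun n => huniq n _ ((generated_iff_ae_eq_filtered hφ).1 (h' n))⟩

end PseudoSpline

end

/-! ### Assembly of the main theorem. -/

theorem mainTheorem4 (z : ℂ) (ℓ : ℕ) (hz : 1 ≤ z.re) (hℓ : (ℓ : ℤ) ≤ ⌊z.re - 1 / 2⌋) :
    (∀ γ : ℝ, Multipliable fun m : ℕ => PseudoSpline.lowpass z ℓ (γ / 2 ^ (m + 1))) ∧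
    (∀ γ : ℝ, PseudoSpline.phiHat z ℓ γ =
      PseudoSpline.lowpass z ℓ (γ / 2) * PseudoSpline.phiHat z ℓ (γ / 2)) ∧
    ((∑ j ∈ Finset.range (ℓ + 1), Real.arctan (z.im / (z.re + j))) ∈
        Set.Ioo (-(Real.pi / 2)) (Real.pi / 2) →
      ∃ σ : ℝ → ℂ, Measurable σ ∧ Function.Periodic σ 1 ∧
        ∀ γ, ‖σ γ‖ ^ 2 = PseudoSpline.eta z ℓ γ) ∧
    ∀ σ : ℝ → ℂ, AEMeasurable σ volume → Function.Periodic σ 1 →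
      (∀ γ, ‖σ γ‖ ^ 2 = PseudoSpline.eta z ℓ γ) →
      (∃! φ : PseudoSpline.L2R, PseudoSpline.IsPseudoSpline z ℓ φ) ∧
      ∀ φ : PseudoSpline.L2R, PseudoSpline.IsPseudoSpline z ℓ φ →
        (∃! ψ : Fin 3 → PseudoSpline.L2R,
          PseudoSpline.IsGeneratedBy (PseudoSpline.highpass z ℓ σ) φ ψ) ∧
        ∀ ψ : Fin 3 → PseudoSpline.L2R,
          PseudoSpline.IsGeneratedBy (PseudoSpline.highpass z ℓ σ) φ ψ →
          PseudoSpline.IsParsevalFrame (PseudoSpline.waveletSystem ψ) := by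
  have hO := PseudoSpline.isBigO_lowpass_sub_one (ℓ := ℓ) hz
  have hz0 : 0 < z.re := by linarith
  have hℓ' : (ℓ : ℝ) ≤ z.re - 1 / 2 := by exact_mod_cast Int.le_floor.1 hℓ
  refine ⟨PseudoSpline.multipliable_dyadic hO, PseudoSpline.dyadicProd_refinement hO,
    fun h => PseudoSpline.exists_measurable_periodic_root hz
      (PseudoSpline.eta_nonneg hz hℓ' (abs_lt.2 h).le), fun σ hσm hσp hσ => ?_⟩
  -- Here `η ≥ 0` comes from `η = |σ|²`, not from the arctangent condition.
  have h1 : ∀ γ, ‖PseudoSpline.lowpass z ℓ γ‖ ^ 2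
      + ‖PseudoSpline.lowpass z ℓ (γ + 1 / 2)‖ ^ 2 ≤ 1 := fun γ => by
    have h := hσ γ
    rw [PseudoSpline.eta] at h
    nlinarith [sq_nonneg ‖σ γ‖]
  have hΦ := PseudoSpline.isRefinable_dyadicProd hO
    (PseudoSpline.continuous_lowpass hz0).measurable (PseudoSpline.lowpass_periodic z ℓ) h1
  have hF := PseudoSpline.isExtensionFilter_highpass hz0 hσm hσp hσ
  exact ⟨PseudoSpline.existsUnique_fourier_eq hΦ.memLp, fun φ hφ =>
    ⟨PseudoSpline.existsUnique_generated hF hΦ hφ, fun ψ hψ =>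
      PseudoSpline.isParsevalFrame_waveletSystem hF hΦ (PseudoSpline.tendsto_dyadicProd_zero hO)
        hφ hψ⟩⟩
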